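/- Notation. Let $\psi=\Gamma'/\Gamma$, $\psi^{(j)}$ its $j$-th derivative, $\gamma$ the Euler--Mascheroni constant. For $\nu\in\mathbb R$, $n\in\mathbb Z$ put $$N=\frac{n}{\nu^2+\frac{n^2}{4}},\quad V=\frac{i\nu}{\nu^2+\frac{n^2}{4}},\quad D_\nu=-i\partial_\nu,\quad E_{\nu,n}=-\frac12\frac{|n|}{\nu^2+\frac{n^2}{4}}+\psi\!\left(1+i\nu+\tfrac{|n|}{2}\right)+\psi\!\left(1-i\nu+\tfrac{|n|}{2}\right)+2\gamma .$$ An admissible integrand is a function $\mathcal F(\nu,n)$ obtained from $E_{\nu,n},V,N$ and complex constants by sums, products and applications of $D_\nu$, which is $[+,+]$-symmetric, i.e. $\mathcal F(\nu,-n)=\mathcal F(\nu,n)=\mathcal F(-\nu,n)$. Its continuation $\mathcal F_+(\nu,n)$ to complex $\nu,n$ is given by the same expression with $|n|$ replaced by $n$; put $\mathcal F_+[\chi_+,\chi_-]=\mathcal F_+\!\left(\tfrac i2(\chi_+-\chi_-),\,\chi_++\chi_-\right)$. For $w=re^{i\phi}\in\mathbb C\setminus\{0\}$ with complex conjugate $w^*$,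 the six-point core functional is $$\mathcal I_6[\mathcal F]=\frac1\pi\sum_{n=-\infty}^{\infty}(-1)^n\left(\frac{w}{w^*}\right)^{n/2}\int_{-\infty}^{\infty}\frac{d\nu}{\nu^2+\frac{n^2}{4}}\,|w|^{2i\nu}\,\mathcal F(\nu,n),\qquad \left(\frac{w}{w^*}\right)^{n/2}:=e^{in\phi}.$$ The $\nu$-integral for $n=0$, here and below, is the finite part at $\nu=0$: the interval $|\nu|\le\varepsilon$ is excluded, a polynomial in $1/\varepsilon$ without constant term is subtracted, and $\varepsilon\to0^+$. The inverse Mellin transform is $\mathcal M^{-1}[G](x)=\lim_{T\to\infty}\frac{1}{2\pi i}\int_{1/4-iT}^{1/4+iT}x^{-s}G(s)\,ds$. Let $\mathcal B$ be the complex linear span of the functions $\chi\mapsto\chi^{-k}\bigl[\prod_j\psi^{(a_j)}(1+\chi)\bigr](\psi(1+\chi)+\gamma)^m$ with $k,m,a_j\in\mathbb N_0$ (finite products). A separation of $\mathcal F_+$ is a finite family of $f_i,g_i\in\mathcal B$ with $\mathcal F_+[\chi_+,\chi_-]=\sum_i f_i(\chi_+)g_i(\chi_-)$ whenever $\operatorname{Re}\chi_\pm>0$.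 Theorem. Let $\mathcal F$ be an admissible integrand. (1) $\mathcal F_+$ has a separation. (2) Let $w\in\mathbb C$, $w\ne0$, $|w|\neq1$. Then the $\nu$-integrals for $n\ne0$ converge absolutely, the finite part for $n=0$ exists, and the series over $n$ in $\mathcal I_6[\mathcal F]$ converges absolutely. For every separation $(f_i,g_i)$ of $\mathcal F_+$, the limits defining $\mathcal M^{-1}[f_i(\chi)/\chi](x)$ and $\mathcal M^{-1}[g_i(\chi)/\chi](x)$ exist for all $x>0$, $x\ne1$; the $u$-integrals below (along straight segments) converge absolutely; and $$\mathcal I_6[\mathcal F]=-2\sum_i\int_0^{w}\frac{du}{u+1}\,\mathcal M^{-1}\!\left[\frac{f_i(\chi_+)}{\chi_+}\right]\!(uw^*)\;\mathcal M^{-1}\!\left[\frac{g_i(\chi_-)}{\chi_-}\right]\!\left(\frac uw\right)+(w\leftrightarrow w^*)+\frac1\pi\int_{-\infty}^{\infty}d\nu\,|w|^{2i\nu}\,\frac{\mathcal F(\nu,0)}{\nu^2},$$ where $(w\leftrightarrow w^*)$ denotes the preceding term with $w$ and $w^*$ exchanged. -/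

import Mathlib

open Filter Topology MeasureTheory Complex ComplexConjugate

noncomputable section

namespace DoubleCopy

/-! ## Integrands -/

/-- Formal polynomial expressions in `E`, `V`, `N` and the derivation `D_ν`, with complex
coefficients.  The constructor `D` applies `D_ν` to a subexpression. -/
inductive Integrand : Type
  | const (c : ℂ)
  | E
  | V
  | N
  | add (a b : Integrand)
  | mul (a b : Integrand)
  | D (a : Integrand)

/-- The BFKL eigenvalue
`E_{ν,n} = -(1/2) |n| / (ν² + n²/4) + ψ(1 + iν + |n|/2) + ψ(1 - iν + |n|/2) + 2γ`. -/
def bfklE (ν : ℝ) (n : ℤ) : ℂ :=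
  -(1 / 2) * ((|n| : ℤ) : ℂ) / ((ν : ℂ) ^ 2 + (n : ℂ) ^ 2 / 4)
    + digamma (1 + I * ν + ((|n| : ℤ) : ℂ) / 2)
    + digamma (1 - I * ν + ((|n| : ℤ) : ℂ) / 2)
    + 2 * (Real.eulerMascheroniConstant : ℂ)

/-- The function `𝓕(ν, n)` of real `ν` and integer `n` given by an expression, with
`N = n / (ν² + n²/4)`, `V = iν / (ν² + n²/4)` and `D_ν = -i ∂_ν`. -/
def Integrand.eval : Integrand → ℝ → ℤ → ℂ
  | .const c, _, _ => c
  | .E, ν, n => bfklE ν n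
  | .V, ν, n => I * ν / ((ν : ℂ) ^ 2 + (n : ℂ) ^ 2 / 4)
  | .N, ν, n => n / ((ν : ℂ) ^ 2 + (n : ℂ) ^ 2 / 4)
  | .add a b, ν, n => a.eval ν n + b.eval ν n
  | .mul a b, ν, n => a.eval ν n * b.eval ν n
  | .D a, ν, n => -I * deriv (fun x : ℝ => a.eval x n) ν

/-- `[+,+]`-symmetry: invariance under `n ↔ -n` and under `(ν, n) ↔ (-ν, -n)`. -/
def Integrand.IsSymmetric (e : Integrand) : Prop :=
  ∀ (ν : ℝ) (n : ℤ), e.eval ν (-n) = e.eval ν n ∧ e.eval (-ν) (-n) = e.eval ν n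

/-- The continuation `𝓕₊(ν, n)` of `𝓕` from positive integers `n` (and real `ν`) to complex `n`
and `ν`: the same expression with `|n|` replaced by `n`. -/
def Integrand.evalPlus : Integrand → ℂ → ℂ → ℂ
  | .const c, _, _ => c
  | .E, ν, n => -(1 / 2) * n / (ν ^ 2 + n ^ 2 / 4)
      + digamma (1 + I * ν + n / 2) + digamma (1 - I * ν + n / 2)
      + 2 * (Real.eulerMascheroniConstant : ℂ)
  | .V, ν, n => I * ν / (ν ^ 2 + n ^ 2 / 4)
  | .N, ν, n => n / (ν ^ 2 + n ^ 2 / 4)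
  | .add a b, ν, n => a.evalPlus ν n + b.evalPlus ν n
  | .mul a b, ν, n => a.evalPlus ν n * b.evalPlus ν n
  | .D a, ν, n => -I * deriv (fun x : ℂ => a.evalPlus x n) ν

/-- `𝓕₊` in the variables `χ₊`, `χ₋`, where `ν = (i/2)(χ₊ - χ₋)` and `n = χ₊ + χ₋`. -/
def Integrand.evalChi (e : Integrand) (χp χm : ℂ) : ℂ :=
  e.evalPlus (I / 2 * (χp - χm)) (χp + χm)

/-! ## Separated form -/

/-- The basis functions `χ ↦ χ⁻ᵏ (∏ⱼ ψ^{(aⱼ)}(1+χ)) (ψ(1+χ) + γ)ᵐ`. -/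
def basisFun (k m : ℕ) (a : List ℕ) (χ : ℂ) : ℂ :=
  1 / χ ^ k * (a.map fun j => iteratedDeriv j digamma (1 + χ)).prod
    * (digamma (1 + χ) + (Real.eulerMascheroniConstant : ℂ)) ^ m

/-- Finite complex linear combinations of the basis functions. -/
def basisSpan : Submodule ℂ (ℂ → ℂ) :=
  Submodule.span ℂ {f | ∃ (k m : ℕ) (a : List ℕ), f = basisFun k m a}

/-- `(f, g)` is a separation `𝓕₊ = ∑ᵢ fᵢ(χ₊) gᵢ(χ₋)` (for `Re χ₊, Re χ₋ > 0`) of the integrand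
with all `fᵢ` and `gᵢ` linear combinations of basis functions. -/
structure IsSeparation (e : Integrand) {m : ℕ} (f g : Fin m → ℂ → ℂ) : Prop where
  left_mem : ∀ i, f i ∈ basisSpan
  right_mem : ∀ i, g i ∈ basisSpan
  eq_sum : ∀ χp χm : ℂ, 0 < χp.re → 0 < χm.re → e.evalChi χp χm = ∑ i, f i χp * g i χm

/-! ## Finite part of an integral over `ℝ` that is singular at the origin -/

/-- `v` is the (Hadamard) finite part of `∫ h(ν) dν` at `ν = 0`: the neighbourhood `|ν| ≤ ε` is
excluded, and after subtraction of a polynomial in `1/ε` without constant term the limit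
`ε → 0⁺` is `v`. If no subtraction is needed this is the Cauchy principal value. -/
def HasFinitePart (h : ℝ → ℂ) (v : ℂ) : Prop :=
  (∀ ε : ℝ, 0 < ε → IntegrableOn h {ν | ε < |ν|}) ∧
    ∃ p : Polynomial ℂ, p.coeff 0 = 0 ∧
      Tendsto (fun ε : ℝ => (∫ ν in {ν : ℝ | ε < |ν|}, h ν) - p.eval ((ε⁻¹ : ℝ) : ℂ))
        (𝓝[>] 0) (𝓝 v)

/-- The finite part does not depend on choices. -/
theorem HasFinitePart.unique {h : ℝ → ℂ} {v v' : ℂ} (hv : HasFinitePart h v)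
    (hv' : HasFinitePart h v') : v = v' := by
  obtain ⟨-, p, hp, ht⟩ := hv
  obtain ⟨-, q, hq, ht'⟩ := hv'
  have h1 : Tendsto (fun ε : ℝ => (q - p).eval ((ε⁻¹ : ℝ) : ℂ)) (𝓝[>] 0) (𝓝 (v - v')) := by
    refine (ht.sub ht').congr fun ε => ?_
    rw [Polynomial.eval_sub]
    ring
  by_cases hd : 0 < (q - p).degree
  · exfalso
    have h2 : Tendsto (fun ε : ℝ => ‖((ε⁻¹ : ℝ) : ℂ)‖) (𝓝[>] 0) atTop := by
      have := tendsto_norm_atTop_atTop.comp (tendsto_inv_nhdsGT_zero (𝕜 := ℝ))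
      refine this.congr fun ε => ?_
      simp
    exact not_tendsto_nhds_of_tendsto_atTop ((q - p).tendsto_norm_atTop hd h2) _ h1.norm
  · have h3 := Polynomial.eq_C_of_degree_le_zero (not_lt.mp hd)
    rw [Polynomial.coeff_sub, hp, hq, sub_zero, Polynomial.C_0] at h3
    rw [h3] at h1
    simp only [Polynomial.eval_zero] at h1
    exact (sub_eq_zero.mp (tendsto_nhds_unique h1 tendsto_const_nhds))

open Classical in
/-- The finite part of `∫ h(ν) dν` (and `0` if there is none). -/
def finitePart (h : ℝ → ℂ) : ℂ :=
  if H : ∃ v, HasFinitePart h v then H.choose else 0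

/-! ## The core functional -/

/-- The integrand `|w|^{2iν} 𝓕(ν, n) / (ν² + n²/4)` of the `ν`-integration. -/
def coreIntegrand (F : ℝ → ℤ → ℂ) (w : ℂ) (n : ℤ) (ν : ℝ) : ℂ :=
  (‖w‖ : ℂ) ^ (2 * I * ν) * F ν n / ((ν : ℂ) ^ 2 + (n : ℂ) ^ 2 / 4)

/-- The `n`-th term of the core functional.  For `w = r e^{iφ}` the factor `(w/w*)^{n/2}` is
`e^{inφ}`.  For `n = 0` the integral is a finite part. -/
def coreTerm (F : ℝ → ℤ → ℂ) (w : ℂ) (n : ℤ) : ℂ :=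
  1 / (Real.pi : ℂ) * (-1) ^ n * exp (I * n * arg w) *
    (if n = 0 then finitePart (coreIntegrand F w 0) else ∫ ν : ℝ, coreIntegrand F w n ν)

/-- The core functional `𝓘₆[𝓕]` at `w`. -/
def coreFunctional (F : ℝ → ℤ → ℂ) (w : ℂ) : ℂ := ∑' n : ℤ, coreTerm F w n

/-- All integrals and the series in the definition of `𝓘₆[𝓕]` converge. -/
structure CoreConverges (F : ℝ → ℤ → ℂ) (w : ℂ) : Prop where
  integrable : ∀ n : ℤ, n ≠ 0 → Integrable (coreIntegrand F w n)
  finitePart_exists : ∃ v, HasFinitePart (coreIntegrand F w 0) v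
  summable : Summable (coreTerm F w)

/-! ## Inverse Mellin transforms and the outer integral -/

/-- The truncated integral `(1/2πi) ∫_{1/4-iT}^{1/4+iT} x^{-s} G(s) ds`. -/
def invMellinTrunc (G : ℂ → ℂ) (x : ℂ) (T : ℝ) : ℂ :=
  1 / (2 * Real.pi * I) *
    ∫ y in (-T)..T, x ^ (-(1 / 4 + y * I)) * G (1 / 4 + y * I) * I

/-- The integral defining the inverse Mellin transform at `x` converges. -/
def InvMellinConverges (G : ℂ → ℂ) (x : ℂ) : Prop :=
  ∃ l, Tendsto (invMellinTrunc G x) atTop (𝓝 l)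

/-- The inverse Mellin transform
`𝓜⁻¹[G](x) = (1/2πi) ∫_{1/4-i∞}^{1/4+i∞} x^{-s} G(s) ds = lim_{T → ∞} (truncated integral)`. -/
def invMellin (G : ℂ → ℂ) (x : ℂ) : ℂ := limUnder atTop (invMellinTrunc G x)

/-- The integrand `(1/(u+1)) 𝓜⁻¹[f(χ)/χ](u w*) 𝓜⁻¹[g(χ)/χ](u/w)` of the outer integral. -/
def outerIntegrand (f g : ℂ → ℂ) (w u : ℂ) : ℂ :=
  1 / (u + 1) * invMellin (fun χ => f χ / χ) (u * conj w) * invMellin (fun χ => g χ / χ) (u / w)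

/-- The integrand of `∫₀ʷ h(u) du` on the straight segment `u = t w`, `0 ≤ t ≤ 1`. -/
def segmentIntegrand (h : ℂ → ℂ) (w : ℂ) (t : ℝ) : ℂ := h (t * w) * w

/-- `∫₀ʷ (du/(u+1)) 𝓜⁻¹[f(χ)/χ](u w*) 𝓜⁻¹[g(χ)/χ](u/w)`, along the straight segment. -/
def doubleCopy (f g : ℂ → ℂ) (w : ℂ) : ℂ :=
  ∫ t in (0 : ℝ)..1, segmentIntegrand (outerIntegrand f g w) w t

/-- The outer integral converges absolutely. -/
def DoubleCopyConverges (f g : ℂ → ℂ) (w : ℂ) : Prop :=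
  IntervalIntegrable (segmentIntegrand (outerIntegrand f g w) w) volume 0 1

end DoubleCopy

end

noncomputable section

namespace DoubleCopy

/-! ## Growth of the digamma function in a half plane -/

/-! In the variables χ± = n/2 ∓ iν one has ν² + n²/4 = χ₊χ₋. Each of `E`, `V`, `N` becomes a
function of χ₊ plus a function of χ₋, and D_ν becomes −∂₊ + ∂₋. The span of the basis functions is
closed under products and derivatives, so structural induction separates every integrand
(`exists_isGlobalSeparation`).

For n ≥ 1 the ν-integral of one product pairs f/χ with g/χ on the line Re χ = n/2. These functions
decay only like |χ|^(−1+ε), because f and g may grow like powers of log |χ|. Their inverse Mellin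
integrals therefore converge conditionally, after one integration by parts. On the line they are
square integrable, and Plancherel gives 2π |w|^n ∫₀^∞ t^(n−1) 𝓜⁻¹[f/χ](t|w|²) 𝓜⁻¹[g/χ](t) dt
(`MellinAdmissible.integral_pow_mul_invMellin`).

Moving the contour to the right shows that both transforms vanish for arguments above 1
(`MellinAdmissible.invMellin_eq_zero`). Only t ≤ 1 with t|w|² ≤ 1 contributes, and there t|w| ≤
min(|w|, 1/|w|) < 1. The sum over n ≥ 1 is thus a uniformly convergent geometric series, ∑ (−1)^n
w^n t^(n−1) = −w/(1 + tw), and u = tw produces the outer integral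
(`doubleCopyConverges_and_hasSum`). By the symmetry in n, the negative n give the same series at the
conjugate of w. The n = 0 integrand extends to a function meromorphic at the origin, hence has a
finite part (`exists_hasFinitePart`), and this term is kept as it is. -/

theorem half_le_norm_natCast_add (k : ℕ) {z : ℂ} (hz : -(1 / 2) ≤ z.re) :
    ((k : ℝ) + 1) / 2 ≤ ‖(k : ℂ) + 1 + z‖ := by
  refine le_trans ?_ (Complex.re_le_norm _)
  have : (0 : ℝ) ≤ k := k.cast_nonneg
  simp only [add_re, natCast_re, one_re]
  linarith

theorem one_add_norm_le_norm_natCast_add (k : ℕ) {z : ℂ} (hz : -(1 / 2) ≤ z.re) :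
    (1 + ‖z‖) / 5 ≤ ‖(k : ℂ) + 1 + z‖ := by
  have h1 := half_le_norm_natCast_add k hz
  have h2 : ‖z‖ ≤ ‖(k : ℂ) + 1 + z‖ + ((k : ℝ) + 1) := by
    calc ‖z‖ = ‖((k : ℂ) + 1 + z) - ((k + 1 : ℕ) : ℂ)‖ := by push_cast; congr 1; ring
      _ ≤ ‖(k : ℂ) + 1 + z‖ + ‖((k + 1 : ℕ) : ℂ)‖ := norm_sub_le _ _
      _ = _ := by rw [Complex.norm_natCast]; push_cast; ring
  have : (0 : ℝ) ≤ k := k.cast_nonneg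
  linarith

theorem natCast_add_ne_zero (k : ℕ) {z : ℂ} (hz : -(1 / 2) ≤ z.re) : (k : ℂ) + 1 + z ≠ 0 := by
  have h1 := half_le_norm_natCast_add k hz
  have : (0 : ℝ) ≤ k := k.cast_nonneg
  rw [← norm_pos_iff]
  linarith

/-- Interpolates between the two preceding lower bounds: a power of k + 1 is spent on summability of
the digamma series, the rest on decay in z. -/
theorem rpow_mul_rpow_le_norm_natCast_add (k : ℕ) {z : ℂ} (hz : -(1 / 2) ≤ z.re) {a b : ℝ}
    (ha : 0 ≤ a) (hb : 0 ≤ b) :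
    ((k : ℝ) + 1) ^ a * (1 + ‖z‖) ^ b ≤ 5 ^ (a + b) * ‖(k : ℂ) + 1 + z‖ ^ (a + b) := by
  have h1 := half_le_norm_natCast_add k hz
  have h2 := one_add_norm_le_norm_natCast_add k hz
  have hk : (0 : ℝ) ≤ k := k.cast_nonneg
  have hx : (0 : ℝ) < 5 * ‖(k : ℂ) + 1 + z‖ := by linarith
  rw [← Real.mul_rpow (by norm_num) (norm_nonneg _), Real.rpow_add hx]
  gcongr <;> linarith

theorem hasDerivAt_tsum_digammaTerm {z : ℂ} (hz : -(1 / 2) < z.re) :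
    HasDerivAt (fun z : ℂ => ∑' k : ℕ, (1 / ((k : ℂ) + 1) - 1 / ((k : ℂ) + 1 + z)))
      (∑' k : ℕ, 1 / ((k : ℂ) + 1 + z) ^ 2) z := by
  have hs : Summable fun k : ℕ => 4 * (1 / ((k + 1 : ℕ) : ℝ) ^ 2) :=
    ((summable_nat_add_iff 1).mpr (Real.summable_one_div_nat_pow.mpr one_lt_two)).mul_left 4
  have hopen : IsOpen {z : ℂ | -(1 / 2) < z.re} := isOpen_lt continuous_const continuous_re
  have hconv : IsPreconnected {z : ℂ | -(1 / 2) < z.re} :=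
    (convex_halfSpace_re_gt _).isPreconnected
  refine hasDerivAt_tsum_of_isPreconnected (y₀ := 0)
    (g := fun (k : ℕ) (z : ℂ) => 1 / ((k : ℂ) + 1) - 1 / ((k : ℂ) + 1 + z))
    (g' := fun (k : ℕ) (z : ℂ) => 1 / ((k : ℂ) + 1 + z) ^ 2) hs hopen hconv (fun k y hy => ?_)
    (fun k y hy => ?_) (by norm_num) ?_ hz
  · have h0 := natCast_add_ne_zero k (le_of_lt hy)
    have := ((hasDerivAt_id y).const_add ((k : ℂ) + 1)).fun_inv h0
    have h3 := this.const_sub (1 / ((k : ℂ) + 1))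
    simp only [one_div, id] at h3 ⊢
    convert! h3 using 1
    field_simp
  · have h1 := half_le_norm_natCast_add k (le_of_lt hy)
    rw [norm_div, norm_one, norm_pow]
    have : (0 : ℝ) < ((k + 1 : ℕ) : ℝ) := by positivity
    calc 1 / ‖(k : ℂ) + 1 + y‖ ^ 2 ≤ 1 / (((k : ℝ) + 1) / 2) ^ 2 := by gcongr
      _ = _ := by push_cast; field_simp; norm_num
  · simp

/-- Logarithmic derivative of the Weierstrass product for Γ(1 + z). The point z = 0 is treated
separately because the product is obtained from Γ(1 + y) = y Γ(y). -/
theorem digamma_one_add_eq_tsum {z : ℂ} (hz : -(1 / 2) < z.re) :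
    digamma (1 + z) = -(Real.eulerMascheroniConstant : ℂ)
      + ∑' k : ℕ, (1 / ((k : ℂ) + 1) - 1 / ((k : ℂ) + 1 + z)) := by
  rcases eq_or_ne z 0 with rfl | hz0
  · simp [digamma_one]
  set ℓ : ℕ → ℂ → ℂ := fun k z => z / (k + 1) - log (1 + z / (k + 1)) with hℓ
  have hd : ∀ (k : ℕ) (y : ℂ), -(1 / 2) < y.re →
      1 + y / (k + 1) ∈ slitPlane := by
    intro k y hy
    left
    have h1 : y / ((k : ℂ) + 1) = y / (((k : ℝ) + 1 : ℝ) : ℂ) := by push_cast; rfl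
    have hk : (0 : ℝ) < (k : ℝ) + 1 := by positivity
    rw [add_re, h1, div_ofReal_re, one_re]
    have : -1 < y.re / ((k : ℝ) + 1) := by
      rw [lt_div_iff₀ hk]
      have : (0 : ℝ) ≤ k := k.cast_nonneg
      linarith
    linarith
  have key : ∀ y : ℂ, -(1 / 2) < y.re →
      HasDerivAt (fun z => ∑' k, ℓ k z)
        (∑' k : ℕ, (1 / ((k : ℂ) + 1) - 1 / ((k : ℂ) + 1 + y))) y ∧
      Summable (fun k => ℓ k y) := by
    intro y hy
    -- The derivatives of the ℓ k are bounded by a multiple of 1/(k+1)² only locally uniformly,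
    -- hence the ball, which contains both y and the base point 0.
    set R := ‖y‖ + 1
    have hs : Summable fun k : ℕ => 2 * R * (1 / ((k + 1 : ℕ) : ℝ) ^ 2) :=
      ((summable_nat_add_iff 1).mpr (Real.summable_one_div_nat_pow.mpr one_lt_two)).mul_left _
    have hopen : IsOpen ({z : ℂ | -(1 / 2) < z.re} ∩ Metric.ball 0 R) :=
      (isOpen_lt continuous_const continuous_re).inter Metric.isOpen_ball
    have hconv : IsPreconnected ({z : ℂ | -(1 / 2) < z.re} ∩ Metric.ball 0 R) :=
      ((convex_halfSpace_re_gt _).inter (convex_ball _ _)).isPreconnected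
    have hR : 0 < R := by positivity
    have hyR : y ∈ {z : ℂ | -(1 / 2) < z.re} ∩ Metric.ball 0 R :=
      ⟨hy, by simp [R]⟩
    have h0R : (0 : ℂ) ∈ {z : ℂ | -(1 / 2) < z.re} ∩ Metric.ball 0 R :=
      ⟨by norm_num, by simpa using hR⟩
    have hD : ∀ (k : ℕ) (x : ℂ), x ∈ {z : ℂ | -(1 / 2) < z.re} ∩ Metric.ball 0 R →
        HasDerivAt (ℓ k) (1 / ((k : ℂ) + 1) - 1 / ((k : ℂ) + 1 + x)) x := by
      intro k x hx
      have h0 := natCast_add_ne_zero k (le_of_lt hx.1)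
      have hk : (k : ℂ) + 1 ≠ 0 := by exact_mod_cast k.succ_ne_zero
      have e1 : HasDerivAt (fun z : ℂ => z / ((k : ℂ) + 1)) (1 / ((k : ℂ) + 1)) x :=
        (hasDerivAt_id x).div_const _
      have e2 := e1.sub ((e1.const_add 1).clog (hd k x hx.1))
      convert! e2 using 1
      have : 1 + x / ((k : ℂ) + 1) ≠ 0 := slitPlane_ne_zero (hd k x hx.1)
      have h4 : 1 + x / ((k : ℂ) + 1) = ((k : ℂ) + 1 + x) / (k + 1) := by field_simp
      rw [h4]
      field_simp
    have hB : ∀ (k : ℕ) (x : ℂ), x ∈ {z : ℂ | -(1 / 2) < z.re} ∩ Metric.ball 0 R →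
        ‖1 / ((k : ℂ) + 1) - 1 / ((k : ℂ) + 1 + x)‖ ≤ 2 * R * (1 / ((k + 1 : ℕ) : ℝ) ^ 2) := by
      intro k x hx
      have h0 := natCast_add_ne_zero k (le_of_lt hx.1)
      have hk : (k : ℂ) + 1 ≠ 0 := by exact_mod_cast k.succ_ne_zero
      have h1 := half_le_norm_natCast_add k (le_of_lt hx.1)
      have hxR : ‖x‖ ≤ R := le_of_lt (by simpa using hx.2)
      have e : 1 / ((k : ℂ) + 1) - 1 / ((k : ℂ) + 1 + x) =
          x / (((k + 1 : ℕ) : ℂ) * ((k : ℂ) + 1 + x)) := by push_cast; field_simp; ring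
      rw [e, norm_div, norm_mul, Complex.norm_natCast]
      have : (0 : ℝ) < ((k + 1 : ℕ) : ℝ) := by positivity
      calc ‖x‖ / (((k + 1 : ℕ) : ℝ) * ‖(k : ℂ) + 1 + x‖)
          ≤ R / (((k + 1 : ℕ) : ℝ) * (((k : ℝ) + 1) / 2)) := by gcongr
        _ = _ := by push_cast; field_simp
    refine ⟨hasDerivAt_tsum_of_isPreconnected hs hopen hconv hD hB h0R ?_ hyR,
      summable_of_summable_hasDerivAt_of_isPreconnected hs hopen hconv hD hB h0R ?_ hyR⟩ <;>
    simp [hℓ]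
  -- Euler's limit formula for Γ. Trading log n for the harmonic number in n^y makes the product
  -- converge and leaves the constant γ.
  have hG : ∀ y : ℂ, -(1 / 2) < y.re → y ≠ 0 →
      Gamma (1 + y) = exp (-(Real.eulerMascheroniConstant : ℂ) * y + ∑' k, ℓ k y) := by
    intro y hy hy0
    have h1 : Tendsto (fun n : ℕ => y * GammaSeq y n) atTop (𝓝 (Gamma (1 + y))) := by
      rw [add_comm, Gamma_add_one y hy0]
      exact (GammaSeq_tendsto_Gamma y).const_mul y
    refine tendsto_nhds_unique h1 ?_
    have h2 : Tendsto (fun n : ℕ => exp (-(((harmonic n : ℚ) : ℝ) - Real.log n : ℝ) * y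
        + ∑ k ∈ Finset.range n, ℓ k y)) atTop
        (𝓝 (exp (-(Real.eulerMascheroniConstant : ℂ) * y + ∑' k, ℓ k y))) := by
      refine (continuous_exp.tendsto _).comp (Tendsto.add (Tendsto.mul_const _ (Tendsto.neg ?_))
        (key y hy).2.hasSum.tendsto_sum_nat)
      exact (continuous_ofReal.tendsto _).comp Real.tendsto_harmonic_sub_log
    refine h2.congr' ?_
    filter_upwards [eventually_ne_atTop 0] with n hn
    have hn' : (n : ℂ) ≠ 0 := Nat.cast_ne_zero.mpr hn
    have e1 : ∑ k ∈ Finset.range n, ℓ k y = y * ((harmonic n : ℚ) : ℂ)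
        - ∑ k ∈ Finset.range n, log (1 + y / (k + 1)) := by
      rw [hℓ, Finset.sum_sub_distrib, harmonic]
      push_cast
      rw [Finset.mul_sum]
      congr 1
    have e2 : ∏ k ∈ Finset.range n, (1 + y / ((k : ℂ) + 1)) =
        exp (∑ k ∈ Finset.range n, log (1 + y / (k + 1))) := by
      rw [exp_sum]
      exact Finset.prod_congr rfl fun k _ => (exp_log (slitPlane_ne_zero (hd k y hy))).symm
    have e3 : ∏ k ∈ Finset.range n, (y + ((k + 1 : ℕ) : ℂ)) =
        (n.factorial : ℂ) * ∏ k ∈ Finset.range n, (1 + y / ((k : ℂ) + 1)) := by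
      rw [← Finset.prod_range_add_one_eq_factorial]
      push_cast
      rw [← Finset.prod_mul_distrib]
      refine Finset.prod_congr rfl fun k _ => ?_
      have hk : (k : ℂ) + 1 ≠ 0 := by exact_mod_cast k.succ_ne_zero
      field_simp
      ring
    have hf : (n.factorial : ℂ) ≠ 0 := Nat.cast_ne_zero.mpr n.factorial_ne_zero
    rw [GammaSeq, Finset.prod_range_succ', e3, e2, cpow_def_of_ne_zero hn', e1, exp_add, exp_sub]
    push_cast
    rw [← Complex.natCast_log, add_zero, neg_mul, exp_neg, sub_mul, exp_sub, mul_comm y]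
    have := exp_ne_zero (∑ k ∈ Finset.range n, log (1 + y / ((k : ℂ) + 1)))
    have := exp_ne_zero (((harmonic n : ℚ) : ℂ) * y)
    field_simp
  have hev : (fun y => Gamma (1 + y)) =ᶠ[𝓝 z] fun y =>
      exp (-(Real.eulerMascheroniConstant : ℂ) * y + ∑' k, ℓ k y) := by
    filter_upwards [(isOpen_lt continuous_const continuous_re).mem_nhds hz,
      isOpen_ne.mem_nhds hz0] with y h1 h2 using hG y h1 h2
  have hder := ((((hasDerivAt_id z).const_mul (-(Real.eulerMascheroniConstant : ℂ))).add
    (key z hz).1).cexp).congr_of_eventuallyEq hev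
  have h3 : deriv Gamma (1 + z) = _ := (deriv_comp_const_add (f := Gamma) 1 z).symm.trans hder.deriv
  rw [digamma_def, logDeriv_apply, h3, hG z hz hz0]
  simp only [Pi.add_apply, id, mul_one]
  rw [mul_div_assoc, mul_comm, div_mul_cancel₀ _ (exp_ne_zero _)]

/-- The true growth is logarithmic; an arbitrarily small power suffices. The k-th term equals
z/((k+1)(k+1+z)), and interpolation with exponents ε and 1 − ε bounds it by a multiple of (1+|z|)^ε
(k+1)^(−1−ε). -/
theorem exists_norm_digamma_one_add_le {ε : ℝ} (hε : 0 < ε) :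
    ∃ C, ∀ z : ℂ, -(1 / 2) < z.re → ‖digamma (1 + z)‖ ≤ C * (1 + ‖z‖) ^ ε := by
  wlog hε1 : ε ≤ 1 generalizing ε
  · obtain ⟨C, hC⟩ := this one_pos le_rfl
    refine ⟨C, fun z hz => (hC z hz).trans ?_⟩
    have hC0 : 0 ≤ C := by
      simpa using (norm_nonneg _).trans (hC 0 (by norm_num))
    gcongr
    · linarith [norm_nonneg z]
    · linarith
  have hs : Summable fun k : ℕ => 1 / ((k + 1 : ℕ) : ℝ) ^ (1 + ε) :=
    (summable_nat_add_iff 1).mpr (Real.summable_one_div_nat_rpow.mpr (by linarith))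
  refine ⟨|Real.eulerMascheroniConstant| + 5 * ∑' k : ℕ, 1 / ((k + 1 : ℕ) : ℝ) ^ (1 + ε),
    fun z hz => ?_⟩
  have hz1 : 0 < 1 + ‖z‖ := by positivity
  have hp : 1 ≤ (1 + ‖z‖) ^ ε := Real.one_le_rpow (by linarith [norm_nonneg z]) hε.le
  have hterm : ∀ k : ℕ, ‖1 / ((k : ℂ) + 1) - 1 / ((k : ℂ) + 1 + z)‖ ≤
      5 * (1 + ‖z‖) ^ ε * (1 / ((k + 1 : ℕ) : ℝ) ^ (1 + ε)) := by
    intro k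
    have h0 := natCast_add_ne_zero k hz.le
    have hk : (k : ℂ) + 1 ≠ 0 := by exact_mod_cast k.succ_ne_zero
    have h1 := rpow_mul_rpow_le_norm_natCast_add k hz.le hε.le (sub_nonneg.mpr hε1)
    rw [add_sub_cancel, Real.rpow_one, Real.rpow_one] at h1
    have e : 1 / ((k : ℂ) + 1) - 1 / ((k : ℂ) + 1 + z) =
        z / (((k + 1 : ℕ) : ℂ) * ((k : ℂ) + 1 + z)) := by push_cast; field_simp; ring
    rw [e, norm_div, norm_mul, Complex.norm_natCast]
    have hk1 : (0 : ℝ) < (k : ℝ) + 1 := by positivity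
    have hn : 0 < ‖(k : ℂ) + 1 + z‖ := norm_pos_iff.mpr h0
    push_cast
    rw [mul_one_div, div_le_div_iff₀ (by positivity) (by positivity)]
    rw [Real.rpow_add hk1, Real.rpow_one]
    have h2 : (1 + ‖z‖) ^ (1 - ε) * (1 + ‖z‖) ^ ε = 1 + ‖z‖ := by
      rw [← Real.rpow_add hz1]; simp
    calc ‖z‖ * (((k : ℝ) + 1) * ((k : ℝ) + 1) ^ ε)
        ≤ (1 + ‖z‖) * (((k : ℝ) + 1) * ((k : ℝ) + 1) ^ ε) := by gcongr; linarith
      _ = ((k : ℝ) + 1) * (1 + ‖z‖) ^ ε * (((k : ℝ) + 1) ^ ε * (1 + ‖z‖) ^ (1 - ε)) := by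
        linear_combination -(((k : ℝ) + 1) * ((k : ℝ) + 1) ^ ε) * h2
      _ ≤ ((k : ℝ) + 1) * (1 + ‖z‖) ^ ε * (5 * ‖(k : ℂ) + 1 + z‖) := by gcongr
      _ = _ := by ring
  rw [digamma_one_add_eq_tsum hz]
  refine (norm_add_le _ _).trans ?_
  have h1 := tsum_of_norm_bounded (hs.mul_left (5 * (1 + ‖z‖) ^ ε)).hasSum hterm
  rw [tsum_mul_left] at h1
  rw [norm_neg, Complex.norm_real, Real.norm_eq_abs, add_mul]
  refine add_le_add (le_mul_of_one_le_right (abs_nonneg _) hp) (h1.trans (le_of_eq ?_))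
  ring

/-- Of the two powers of |k+1+z|, 3/2 go to convergence of the sum over k and 1/2 to decay in z.
This is weaker than the true 1/|z| but enough below. -/
theorem exists_norm_deriv_digamma_one_add_le :
    ∃ C, ∀ z : ℂ, -(1 / 2) < z.re → ‖deriv digamma (1 + z)‖ ≤ C * (1 + ‖z‖) ^ (-(1 / 2) : ℝ) := by
  have hs : Summable fun k : ℕ => 1 / ((k + 1 : ℕ) : ℝ) ^ (3 / 2 : ℝ) :=
    (summable_nat_add_iff 1).mpr (Real.summable_one_div_nat_rpow.mpr (by norm_num))
  refine ⟨25 * ∑' k : ℕ, 1 / ((k + 1 : ℕ) : ℝ) ^ (3 / 2 : ℝ), fun z hz => ?_⟩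
  have hd : deriv digamma (1 + z) = ∑' k : ℕ, 1 / ((k : ℂ) + 1 + z) ^ 2 := by
    rw [← deriv_comp_const_add (f := digamma)]
    refine HasDerivAt.deriv (((hasDerivAt_tsum_digammaTerm hz).const_add
      (-(Real.eulerMascheroniConstant : ℂ))).congr_of_eventuallyEq ?_)
    filter_upwards [(isOpen_lt continuous_const continuous_re).mem_nhds hz] with y hy
    exact digamma_one_add_eq_tsum hy
  have hz1 : 0 < 1 + ‖z‖ := by positivity
  have hterm : ∀ k : ℕ, ‖1 / ((k : ℂ) + 1 + z) ^ 2‖ ≤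
      25 * (1 + ‖z‖) ^ (-(1 / 2) : ℝ) * (1 / ((k + 1 : ℕ) : ℝ) ^ (3 / 2 : ℝ)) := by
    intro k
    have h0 := natCast_add_ne_zero k hz.le
    have h1 := rpow_mul_rpow_le_norm_natCast_add k hz.le (a := 3 / 2) (b := 1 / 2)
      (by norm_num) (by norm_num)
    rw [show (3 / 2 + 1 / 2 : ℝ) = (2 : ℕ) by norm_num, Real.rpow_natCast, Real.rpow_natCast] at h1
    have hn : 0 < ‖(k : ℂ) + 1 + z‖ := norm_pos_iff.mpr h0
    rw [norm_div, norm_one, norm_pow, Real.rpow_neg hz1.le, ← div_eq_mul_inv, div_mul_div_comm,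
      div_le_div_iff₀ (by positivity) (by positivity)]
    push_cast
    linarith
  rw [hd]
  refine (tsum_of_norm_bounded (hs.mul_left _).hasSum hterm).trans (le_of_eq ?_)
  rw [tsum_mul_left]
  ring

/-! ## The regular set of the basis functions -/

/-- The complement of the nonpositive integers. -/
def regularSet : Set ℂ := {χ | ∀ k : ℕ, χ ≠ -k}

/-- With the convention Γ = 0 at the poles, 1/Γ is an entire function whose zeros are exactly the
excluded points. -/
theorem isOpen_regularSet : IsOpen regularSet := by
  have : regularSet = (fun χ => (Gamma χ)⁻¹) ⁻¹' {0}ᶜ := by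
    ext χ
    simp [regularSet, Gamma_eq_zero_iff]
  rw [this]
  exact isOpen_compl_singleton.preimage differentiable_one_div_Gamma.continuous

theorem mem_regularSet_of_re_pos {χ : ℂ} (h : 0 < χ.re) : χ ∈ regularSet := by
  rintro k rfl
  have : (0 : ℝ) ≤ k := k.cast_nonneg
  simp at h
  linarith

theorem mem_regularSet_of_re_nonneg {χ : ℂ} (h : 0 ≤ χ.re) (h0 : χ ≠ 0) : χ ∈ regularSet := by
  rintro k rfl
  have : (0 : ℝ) ≤ k := k.cast_nonneg
  simp only [neg_re, natCast_re] at h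
  have hk : (k : ℝ) = 0 := by linarith
  exact h0 (by simpa using hk)

theorem one_add_mem_regularSet {χ : ℂ} (h : χ ∈ regularSet) : 1 + χ ∈ regularSet := by
  intro k hk
  refine h (k + 1) ?_
  push_cast
  linear_combination hk

theorem ne_zero_of_mem_regularSet {χ : ℂ} (h : χ ∈ regularSet) : χ ≠ 0 := by
  simpa using h 0

theorem differentiableOn_digamma : DifferentiableOn ℂ digamma regularSet := by
  have h : DifferentiableOn ℂ Gamma regularSet := fun χ hχ =>
    (differentiableAt_Gamma χ hχ).differentiableWithinAt
  exact (h.deriv isOpen_regularSet).div h fun χ hχ => Gamma_ne_zero hχ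

theorem analyticAt_digamma {χ : ℂ} (h : χ ∈ regularSet) : AnalyticAt ℂ digamma χ :=
  differentiableOn_digamma.analyticAt (isOpen_regularSet.mem_nhds h)

/-- Cauchy's estimate for ψ′ on a circle of radius 1/4, which stays inside the half plane where ψ′
is already bounded. On the circle 1 + |z| changes by at most a factor 2, so the decay exponent is
preserved. -/
theorem exists_norm_iteratedDeriv_digamma_le (j : ℕ) :
    ∃ C, ∀ z : ℂ, 0 ≤ z.re →
      ‖iteratedDeriv (j + 1) digamma (1 + z)‖ ≤ C * (1 + ‖z‖) ^ (-(1 / 2) : ℝ) := by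
  obtain ⟨C, hC⟩ := exists_norm_deriv_digamma_one_add_le
  have hC0 : 0 ≤ C := by
    simpa using (norm_nonneg _).trans (hC 0 (by norm_num))
  refine ⟨j.factorial * (C * (1 / 2 : ℝ) ^ (-(1 / 2) : ℝ)) / (1 / 4) ^ j, fun z hz => ?_⟩
  have hre : ∀ w : ℂ, w ∈ Metric.closedBall (1 + z) (1 / 4) → -(1 / 2) < (w - 1).re := by
    intro w hw
    rw [mem_closedBall_iff_norm] at hw
    have := (abs_le.mp ((Complex.abs_re_le_norm _).trans hw)).1
    simp only [sub_re, add_re, one_re] at this ⊢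
    linarith
  have hmem : ∀ w : ℂ, w ∈ Metric.closedBall (1 + z) (1 / 4) → w ∈ regularSet := by
    intro w hw
    have := hre w hw
    refine mem_regularSet_of_re_pos ?_
    simp only [sub_re, one_re] at this
    linarith
  have hd : DiffContOnCl ℂ (deriv digamma) (Metric.ball (1 + z) (1 / 4)) := by
    refine DifferentiableOn.diffContOnCl_ball (U := regularSet)
      (differentiableOn_digamma.deriv isOpen_regularSet) hmem
  have hb := norm_iteratedDeriv_le_of_forall_mem_sphere_norm_le (n := j) (by norm_num) hd
    (C := C * ((1 / 2) * (1 + ‖z‖)) ^ (-(1 / 2) : ℝ)) fun w hw => by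
      have h1 := hC (w - 1) (hre w (Metric.sphere_subset_closedBall hw))
      rw [add_sub_cancel] at h1
      refine h1.trans ?_
      gcongr ?_ * ?_
      refine Real.rpow_le_rpow_of_nonpos (by positivity) ?_ (by norm_num)
      rw [mem_sphere_iff_norm] at hw
      have h2 : ‖z‖ ≤ ‖w - (1 + z)‖ + ‖w - 1‖ := by
        rw [← norm_neg (w - (1 + z))]
        refine le_trans (le_of_eq ?_) (norm_add_le _ _)
        congr 1; ring
      linarith [norm_nonneg z]
  rw [iteratedDeriv_succ']
  refine hb.trans (le_of_eq ?_)
  rw [Real.mul_rpow (by norm_num) (by positivity)]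
  ring

/-! ## The algebra of basis functions -/

theorem basisFun_mem (k m : ℕ) (a : List ℕ) : basisFun k m a ∈ basisSpan :=
  Submodule.subset_span ⟨k, m, a, rfl⟩

theorem basisFun_mul (k m k' m' : ℕ) (a a' : List ℕ) :
    basisFun k m a * basisFun k' m' a' = basisFun (k + k') (m + m') (a ++ a') := by
  funext χ
  simp only [basisFun, Pi.mul_apply, List.map_append, List.prod_append, pow_add, one_div, mul_inv]
  ring

theorem mul_mem_basisSpan {f g : ℂ → ℂ} (hf : f ∈ basisSpan) (hg : g ∈ basisSpan) :
    f * g ∈ basisSpan := by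
  have h := Submodule.mul_mem_mul hf hg
  rw [basisSpan, Submodule.span_mul_span] at h
  refine Submodule.span_mono ?_ h
  rintro _ ⟨_, ⟨k, m, a, rfl⟩, _, ⟨k', m', a', rfl⟩, rfl⟩
  exact ⟨_, _, _, basisFun_mul ..⟩

theorem one_mem_basisSpan : (1 : ℂ → ℂ) ∈ basisSpan := by
  convert! basisFun_mem 0 0 []
  funext χ
  simp [basisFun]

theorem const_mem_basisSpan (c : ℂ) : (fun _ : ℂ => c) ∈ basisSpan := by
  have : (fun _ : ℂ => c) = c • (1 : ℂ → ℂ) := by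
    funext χ
    simp
  exact this ▸ basisSpan.smul_mem c one_mem_basisSpan

theorem inv_mem_basisSpan : (fun χ : ℂ => χ⁻¹) ∈ basisSpan := by
  convert! basisFun_mem 1 0 []
  funext χ
  simp [basisFun]

theorem iteratedDeriv_digamma_mem_basisSpan (j : ℕ) :
    (fun χ : ℂ => iteratedDeriv j digamma (1 + χ)) ∈ basisSpan := by
  have : (fun χ : ℂ => iteratedDeriv j digamma (1 + χ)) = basisFun 0 0 [j] := by
    funext χ
    simp [basisFun]
  exact this ▸ basisFun_mem 0 0 [j]

theorem analyticAt_iteratedDeriv_digamma (j : ℕ) {χ : ℂ} (hχ : χ ∈ regularSet) :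
    AnalyticAt ℂ (iteratedDeriv j digamma) χ := by
  rw [iteratedDeriv_eq_iterate]
  exact (analyticAt_digamma hχ).iterated_deriv j

theorem hasDerivAt_iteratedDeriv_digamma (j : ℕ) {χ : ℂ} (hχ : χ ∈ regularSet) :
    HasDerivAt (fun χ : ℂ => iteratedDeriv j digamma (1 + χ))
      (iteratedDeriv (j + 1) digamma (1 + χ)) χ := by
  have h : DifferentiableAt ℂ (iteratedDeriv j digamma) (1 + χ) :=
    (analyticAt_iteratedDeriv_digamma j (one_add_mem_regularSet hχ)).differentiableAt
  have := h.hasDerivAt.comp_const_add 1 χ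
  rwa [← iteratedDeriv_succ] at this

/-- A property of functions that passes to sums, products and scalar multiples, and holds for
`1/χ` and the polygamma functions, holds on `basisSpan`. -/
theorem basisSpan_induction {p : (ℂ → ℂ) → Prop} (inv : p fun χ => χ⁻¹)
    (poly : ∀ j, p fun χ => iteratedDeriv j digamma (1 + χ)) (const : ∀ c : ℂ, p fun _ => c)
    (add : ∀ f g, p f → p g → p (f + g)) (mul : ∀ f g, p f → p g → p (f * g))
    {f : ℂ → ℂ} (hf : f ∈ basisSpan) : p f := by
  have hpow : ∀ (f : ℂ → ℂ), p f → ∀ k : ℕ, p (f ^ k) := by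
    intro f hf k
    induction k with
    | zero => rw [pow_zero]; exact const 1
    | succ k ih => rw [pow_succ]; exact mul _ _ ih hf
  induction hf using Submodule.span_induction with
  | mem f hf =>
    obtain ⟨k, m, a, rfl⟩ := hf
    have hlist : p fun χ => (a.map fun j => iteratedDeriv j digamma (1 + χ)).prod := by
      induction a with
      | nil => exact const 1
      | cons j a ih =>
        simp only [List.map_cons, List.prod_cons]
        exact mul _ _ (poly j) ih
    have h0 := poly 0
    simp only [iteratedDeriv_zero] at h0
    have := mul _ _ (mul _ _ (hpow _ inv k) hlist) (hpow _ (add _ _ h0 (const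
      (Real.eulerMascheroniConstant : ℂ))) m)
    convert! this using 1
    funext χ
    simp [basisFun]
  | zero => exact const 0
  | add f g _ _ hf hg => exact add f g hf hg
  | smul c f _ hf => exact mul _ _ (const c) hf

theorem exists_hasDerivAt_of_mem_basisSpan {f : ℂ → ℂ} (hf : f ∈ basisSpan) :
    ∃ f' ∈ basisSpan, ∀ χ ∈ regularSet, HasDerivAt f (f' χ) χ := by
  -- Membership of f is carried through the induction because the product rule puts f and g
  -- themselves into the derivative.
  have : f ∈ basisSpan ∧ ∃ f' ∈ basisSpan, ∀ χ ∈ regularSet, HasDerivAt f (f' χ) χ := by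
    refine basisSpan_induction (p := fun f => f ∈ basisSpan ∧
      ∃ f' ∈ basisSpan, ∀ χ ∈ regularSet, HasDerivAt f (f' χ) χ) ?_ ?_ ?_ ?_ ?_ hf
    · refine ⟨inv_mem_basisSpan, _, basisSpan.neg_mem
        (mul_mem_basisSpan inv_mem_basisSpan inv_mem_basisSpan), fun χ hχ => ?_⟩
      convert! hasDerivAt_inv (ne_zero_of_mem_regularSet hχ) using 1
      simp [pow_two]
    · exact fun j => ⟨iteratedDeriv_digamma_mem_basisSpan j, _,
        iteratedDeriv_digamma_mem_basisSpan (j + 1),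
        fun χ hχ => hasDerivAt_iteratedDeriv_digamma j hχ⟩
    · exact fun c => ⟨const_mem_basisSpan c, _, const_mem_basisSpan 0,
        fun χ _ => hasDerivAt_const χ c⟩
    · rintro f g ⟨hf, f', hf', hdf⟩ ⟨hg, g', hg', hdg⟩
      exact ⟨basisSpan.add_mem hf hg, _, basisSpan.add_mem hf' hg',
        fun χ hχ => (hdf χ hχ).add (hdg χ hχ)⟩
    · rintro f g ⟨hf, f', hf', hdf⟩ ⟨hg, g', hg', hdg⟩
      exact ⟨mul_mem_basisSpan hf hg, _, basisSpan.add_mem (mul_mem_basisSpan hf' hg)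
        (mul_mem_basisSpan hf hg'), fun χ hχ => (hdf χ hχ).mul (hdg χ hχ)⟩
  exact this.2

/-- The growth of elements of `basisSpan` in the right half plane, away from the origin. -/
structure HasSlowGrowth (f : ℂ → ℂ) : Prop where
  differentiableAt : ∀ χ ∈ regularSet, DifferentiableAt ℂ f χ
  meromorphicAt : MeromorphicAt f 0
  norm_le : ∀ ε : ℝ, 0 < ε → ∃ C, ∀ χ : ℂ, 0 ≤ χ.re → 1 / 4 ≤ ‖χ‖ → ‖f χ‖ ≤ C * (1 + ‖χ‖) ^ ε
  norm_deriv_le : ∀ ε : ℝ, 0 < ε → ∃ C, ∀ χ : ℂ, 0 ≤ χ.re → 1 / 4 ≤ ‖χ‖ →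
    ‖deriv f χ‖ ≤ C * (1 + ‖χ‖) ^ (ε - 1 / 2)

/-! ### Slow growth of the generators and stability under sums and products. -/

theorem mem_regularSet_of_quarter_le {χ : ℂ} (h : 0 ≤ χ.re) (h4 : 1 / 4 ≤ ‖χ‖) :
    χ ∈ regularSet :=
  mem_regularSet_of_re_nonneg h (norm_pos_iff.mp (by linarith))

theorem HasSlowGrowth.inv : HasSlowGrowth fun χ => χ⁻¹ where
  differentiableAt χ hχ := differentiableAt_inv (ne_zero_of_mem_regularSet hχ)
  meromorphicAt := MeromorphicAt.id 0 |>.inv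
  norm_le ε hε := by
    refine ⟨4, fun χ _ h => ?_⟩
    rw [norm_inv]
    have h1 : 1 ≤ (1 + ‖χ‖) ^ ε := Real.one_le_rpow (by linarith) hε.le
    have h2 : ‖χ‖⁻¹ ≤ 4 := by
      rw [inv_le_comm₀ (by linarith) (by norm_num)]; linarith
    nlinarith
  norm_deriv_le ε hε := by
    refine ⟨5 ^ (2 : ℕ), fun χ _ h => ?_⟩
    have h0 : 0 < ‖χ‖ := by linarith
    rw [deriv_inv, norm_neg, norm_inv, norm_pow]
    have h1 : (1 + ‖χ‖) ^ (-(2 : ℕ) : ℝ) ≤ (1 + ‖χ‖) ^ (ε - 1 / 2) :=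
      Real.rpow_le_rpow_of_exponent_le (by linarith) (by push_cast; linarith)
    refine le_trans ?_ (mul_le_mul_of_nonneg_left h1 (by norm_num))
    rw [Real.rpow_neg (by linarith), Real.rpow_natCast, ← div_eq_mul_inv, inv_eq_one_div,
      div_le_div_iff₀ (by positivity) (by positivity), one_mul, ← mul_pow]
    gcongr
    linarith

theorem HasSlowGrowth.const (c : ℂ) : HasSlowGrowth fun _ => c where
  differentiableAt χ _ := differentiableAt_const c
  meromorphicAt := MeromorphicAt.const c 0
  norm_le ε hε := ⟨‖c‖, fun χ _ _ => le_mul_of_one_le_right (norm_nonneg _)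
    (Real.one_le_rpow (by linarith [norm_nonneg χ]) hε.le)⟩
  norm_deriv_le ε hε := ⟨0, fun χ _ _ => by simp⟩

/-- Only ψ itself can grow. Every derivative that occurs is a polygamma function of positive order
and decays like |χ|^(−1/2) or better. -/
theorem HasSlowGrowth.polygamma (j : ℕ) :
    HasSlowGrowth fun χ => iteratedDeriv j digamma (1 + χ) where
  differentiableAt χ hχ := (hasDerivAt_iteratedDeriv_digamma j hχ).differentiableAt
  meromorphicAt := by
    refine AnalyticAt.meromorphicAt ?_
    have h : AnalyticAt ℂ (iteratedDeriv j digamma) (1 + 0) := by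
      rw [add_zero]
      exact analyticAt_iteratedDeriv_digamma j (mem_regularSet_of_re_pos (by simp))
    exact h.fun_comp (f := fun χ : ℂ => 1 + χ) (analyticAt_const.add analyticAt_id)
  norm_le ε hε := by
    cases j with
    | zero =>
      obtain ⟨C, hC⟩ := exists_norm_digamma_one_add_le hε
      exact ⟨C, fun χ hχ _ => by simpa using hC χ (by linarith)⟩
    | succ j =>
      obtain ⟨C, hC⟩ := exists_norm_iteratedDeriv_digamma_le j
      have hC0 : 0 ≤ C := by
        simpa using (norm_nonneg _).trans (hC 0 (by norm_num))
      refine ⟨C, fun χ hχ _ => (hC χ hχ).trans ?_⟩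
      gcongr
      · linarith [norm_nonneg χ]
      · linarith
  norm_deriv_le ε hε := by
    obtain ⟨C, hC⟩ := exists_norm_iteratedDeriv_digamma_le j
    have hC0 : 0 ≤ C := by
      simpa using (norm_nonneg _).trans (hC 0 (by norm_num))
    refine ⟨C, fun χ hχ h4 => ?_⟩
    rw [(hasDerivAt_iteratedDeriv_digamma j (mem_regularSet_of_quarter_le hχ h4)).deriv]
    refine (hC χ hχ).trans ?_
    gcongr
    · linarith [norm_nonneg χ]
    · linarith

theorem HasSlowGrowth.add {f g : ℂ → ℂ} (hf : HasSlowGrowth f) (hg : HasSlowGrowth g) :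
    HasSlowGrowth (f + g) where
  differentiableAt χ hχ := (hf.differentiableAt χ hχ).add (hg.differentiableAt χ hχ)
  meromorphicAt := hf.meromorphicAt.add hg.meromorphicAt
  norm_le ε hε := by
    obtain ⟨C, hC⟩ := hf.norm_le ε hε
    obtain ⟨C', hC'⟩ := hg.norm_le ε hε
    refine ⟨C + C', fun χ hχ h4 => (norm_add_le _ _).trans ?_⟩
    rw [add_mul]
    exact add_le_add (hC χ hχ h4) (hC' χ hχ h4)
  norm_deriv_le ε hε := by
    obtain ⟨C, hC⟩ := hf.norm_deriv_le ε hε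
    obtain ⟨C', hC'⟩ := hg.norm_deriv_le ε hε
    refine ⟨C + C', fun χ hχ h4 => ?_⟩
    have hm := mem_regularSet_of_quarter_le hχ h4
    rw [deriv_add (hf.differentiableAt χ hm) (hg.differentiableAt χ hm), add_mul]
    exact (norm_add_le _ _).trans (add_le_add (hC χ hχ h4) (hC' χ hχ h4))

/-- Each factor receives ε/2; quantifying over all ε is what makes the condition stable under
products. -/
theorem HasSlowGrowth.mul {f g : ℂ → ℂ} (hf : HasSlowGrowth f) (hg : HasSlowGrowth g) :
    HasSlowGrowth (f * g) where
  differentiableAt χ hχ := (hf.differentiableAt χ hχ).mul (hg.differentiableAt χ hχ)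
  meromorphicAt := hf.meromorphicAt.mul hg.meromorphicAt
  norm_le ε hε := by
    obtain ⟨C, hC⟩ := hf.norm_le (ε / 2) (by linarith)
    obtain ⟨C', hC'⟩ := hg.norm_le (ε / 2) (by linarith)
    refine ⟨C * C', fun χ hχ h4 => ?_⟩
    rw [Pi.mul_apply, norm_mul]
    refine (mul_le_mul (hC χ hχ h4) (hC' χ hχ h4) (norm_nonneg _)
      ((norm_nonneg _).trans (hC χ hχ h4))).trans (le_of_eq ?_)
    rw [mul_mul_mul_comm, ← Real.rpow_add (by positivity)]
    congr 2
    ring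
  norm_deriv_le ε hε := by
    obtain ⟨C, hC⟩ := hf.norm_le (ε / 2) (by linarith)
    obtain ⟨C', hC'⟩ := hg.norm_le (ε / 2) (by linarith)
    obtain ⟨D, hD⟩ := hf.norm_deriv_le (ε / 2) (by linarith)
    obtain ⟨D', hD'⟩ := hg.norm_deriv_le (ε / 2) (by linarith)
    refine ⟨D * C' + C * D', fun χ hχ h4 => ?_⟩
    have hm := mem_regularSet_of_quarter_le hχ h4
    rw [deriv_mul (hf.differentiableAt χ hm) (hg.differentiableAt χ hm)]
    refine (norm_add_le _ _).trans ?_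
    rw [norm_mul, norm_mul]
    refine (add_le_add
      (mul_le_mul (hD χ hχ h4) (hC' χ hχ h4) (norm_nonneg _)
        ((norm_nonneg _).trans (hD χ hχ h4)))
      (mul_le_mul (hC χ hχ h4) (hD' χ hχ h4) (norm_nonneg _)
        ((norm_nonneg _).trans (hC χ hχ h4)))).trans (le_of_eq ?_)
    rw [mul_mul_mul_comm, mul_mul_mul_comm C, ← Real.rpow_add (by positivity),
      ← Real.rpow_add (by positivity), add_mul]
    congr 3 <;> ring

theorem hasSlowGrowth_of_mem_basisSpan {f : ℂ → ℂ} (hf : f ∈ basisSpan) : HasSlowGrowth f :=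
  basisSpan_induction (p := HasSlowGrowth) .inv .polygamma .const (fun _ _ => .add)
    (fun _ _ => .mul) hf

/-! ## Existence of separations -/

theorem neg_I_mul_I_div_two_mul_sub (χp χm : ℂ) :
    (χp + χm) / 2 - I * (I / 2 * (χp - χm)) = χp := by
  linear_combination (-(χp - χm) / 2) * I_sq

theorem I_mul_I_div_two_mul_sub (χp χm : ℂ) :
    (χp + χm) / 2 + I * (I / 2 * (χp - χm)) = χm := by
  linear_combination ((χp - χm) / 2) * I_sq

theorem sq_add_sq_div_four (χp χm : ℂ) :
    (I / 2 * (χp - χm)) ^ 2 + (χp + χm) ^ 2 / 4 = χp * χm := by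
  linear_combination ((χp - χm) ^ 2 / 4) * I_sq

theorem evalPlus_eq_evalChi (e : Integrand) (ν n : ℂ) :
    e.evalPlus ν n = e.evalChi (n / 2 - I * ν) (n / 2 + I * ν) := by
  rw [Integrand.evalChi]
  congr 1
  · linear_combination ν * I_sq
  · ring

/-- A separation that holds wherever both sides are regular. -/
def IsGlobalSeparation (e : Integrand) {ι : Type} [Fintype ι] (f g : ι → ℂ → ℂ) : Prop :=
  (∀ i, f i ∈ basisSpan) ∧ (∀ i, g i ∈ basisSpan) ∧
    ∀ χp ∈ regularSet, ∀ χm ∈ regularSet, e.evalChi χp χm = ∑ i, f i χp * g i χm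

theorem hasDerivAt_sum_mul {ι : Type} [Fintype ι] {f g f' g' : ι → ℂ → ℂ}
    (hf : ∀ i, ∀ χ ∈ regularSet, HasDerivAt (f i) (f' i χ) χ)
    (hg : ∀ i, ∀ χ ∈ regularSet, HasDerivAt (g i) (g' i χ) χ) {n ν : ℂ}
    (hp : n / 2 - I * ν ∈ regularSet) (hm : n / 2 + I * ν ∈ regularSet) :
    HasDerivAt (fun ν => ∑ i, f i (n / 2 - I * ν) * g i (n / 2 + I * ν))
      (∑ i, (f' i (n / 2 - I * ν) * (-I) * g i (n / 2 + I * ν) +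
        f i (n / 2 - I * ν) * (g' i (n / 2 + I * ν) * I))) ν := by
  refine HasDerivAt.fun_sum fun i _ => ?_
  have h1 : HasDerivAt (fun ν : ℂ => n / 2 - I * ν) (-I) ν := by
    simpa using ((hasDerivAt_id ν).const_mul I).const_sub (n / 2)
  have h2 : HasDerivAt (fun ν : ℂ => n / 2 + I * ν) I ν := by
    simpa using ((hasDerivAt_id ν).const_mul I).const_add (n / 2)
  exact ((hf i _ hp).comp ν h1).mul ((hg i _ hm).comp ν h2)

theorem eventually_mem_regularSet {n ν : ℂ}
    (hp : n / 2 - I * ν ∈ regularSet) (hm : n / 2 + I * ν ∈ regularSet) :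
    ∀ᶠ x in 𝓝 ν, n / 2 - I * x ∈ regularSet ∧ n / 2 + I * x ∈ regularSet := by
  have h1 : ContinuousAt (fun ν : ℂ => n / 2 - I * ν) ν := by fun_prop
  have h2 : ContinuousAt (fun ν : ℂ => n / 2 + I * ν) ν := by fun_prop
  exact (h1.eventually (isOpen_regularSet.mem_nhds hp)).and
    (h2.eventually (isOpen_regularSet.mem_nhds hm))

theorem IsGlobalSeparation.hasDerivAt {e : Integrand} {ι : Type} [Fintype ι]
    {f g f' g' : ι → ℂ → ℂ} (h : IsGlobalSeparation e f g)
    (hf : ∀ i, ∀ χ ∈ regularSet, HasDerivAt (f i) (f' i χ) χ)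
    (hg : ∀ i, ∀ χ ∈ regularSet, HasDerivAt (g i) (g' i χ) χ) {n ν : ℂ}
    (hp : n / 2 - I * ν ∈ regularSet) (hm : n / 2 + I * ν ∈ regularSet) :
    HasDerivAt (fun ν => e.evalPlus ν n)
      (∑ i, (f' i (n / 2 - I * ν) * (-I) * g i (n / 2 + I * ν) +
        f i (n / 2 - I * ν) * (g' i (n / 2 + I * ν) * I))) ν := by
  refine (hasDerivAt_sum_mul hf hg hp hm).congr_of_eventuallyEq ?_
  filter_upwards [eventually_mem_regularSet hp hm] with x hx
  rw [evalPlus_eq_evalChi, h.2.2 _ hx.1 _ hx.2]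

/-- The domain Re χ± > 0 would be too small: the n = 0 term lives on the imaginary axis. The regular
set contains that axis without 0 and is open, so the identity can be differentiated. -/
theorem exists_isGlobalSeparation (e : Integrand) :
    ∃ (ι : Type) (_ : Fintype ι) (f g : ι → ℂ → ℂ), IsGlobalSeparation e f g := by
  induction e with
  | const c =>
    refine ⟨Unit, inferInstance, fun _ _ => c, fun _ => 1, fun _ => const_mem_basisSpan c,
      fun _ => one_mem_basisSpan, fun χp _ χm _ => ?_⟩
    simp [Integrand.evalChi, Integrand.evalPlus]
  | E =>
    set u : ℂ → ℂ := fun χ => (-(1 / 2)) * χ⁻¹ + iteratedDeriv 0 digamma (1 + χ)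
      + Real.eulerMascheroniConstant with hu
    have hmem : u ∈ basisSpan :=
      basisSpan.add_mem (basisSpan.add_mem (basisSpan.smul_mem _ inv_mem_basisSpan)
        (iteratedDeriv_digamma_mem_basisSpan 0)) (const_mem_basisSpan _)
    refine ⟨Bool, inferInstance, fun b => bif b then u else 1, fun b => bif b then 1 else u,
      ?_, ?_, fun χp hp χm hm => ?_⟩
    · rintro (_ | _) <;> simp [hmem, one_mem_basisSpan]
    · rintro (_ | _) <;> simp [hmem, one_mem_basisSpan]
    · have hp0 := ne_zero_of_mem_regularSet hp
      have hm0 := ne_zero_of_mem_regularSet hm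
      simp only [Integrand.evalChi, Integrand.evalPlus, Fintype.sum_bool, cond_true, cond_false,
        sq_add_sq_div_four, hu, iteratedDeriv_zero, Pi.one_apply]
      rw [show 1 + I * (I / 2 * (χp - χm)) + (χp + χm) / 2 = 1 + χm by
          linear_combination I_mul_I_div_two_mul_sub χp χm,
        show 1 - I * (I / 2 * (χp - χm)) + (χp + χm) / 2 = 1 + χp by
          linear_combination neg_I_mul_I_div_two_mul_sub χp χm]
      field_simp
      ring
  | V =>
    refine ⟨Bool, inferInstance, fun b => bif b then (fun χ => 1 / 2 * χ⁻¹) else 1,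
      fun b => bif b then 1 else (fun χ => -(1 / 2) * χ⁻¹), ?_, ?_, fun χp hp χm hm => ?_⟩
    · rintro (_ | _)
      · simp [one_mem_basisSpan]
      · exact basisSpan.smul_mem _ inv_mem_basisSpan
    · rintro (_ | _)
      · exact basisSpan.smul_mem _ inv_mem_basisSpan
      · simp [one_mem_basisSpan]
    · have hp0 := ne_zero_of_mem_regularSet hp
      have hm0 := ne_zero_of_mem_regularSet hm
      simp only [Integrand.evalChi, Integrand.evalPlus, Fintype.sum_bool, cond_true, cond_false,
        sq_add_sq_div_four, Pi.one_apply]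
      rw [show I * (I / 2 * (χp - χm)) = (χm - χp) / 2 by
        linear_combination ((χp - χm) / 2) * I_sq]
      field_simp
      ring
  | N =>
    refine ⟨Bool, inferInstance, fun b => bif b then (fun χ => χ⁻¹) else 1,
      fun b => bif b then 1 else (fun χ => χ⁻¹), ?_, ?_, fun χp hp χm hm => ?_⟩
    · rintro (_ | _) <;> simp [one_mem_basisSpan, inv_mem_basisSpan]
    · rintro (_ | _) <;> simp [one_mem_basisSpan, inv_mem_basisSpan]
    · have hp0 := ne_zero_of_mem_regularSet hp
      have hm0 := ne_zero_of_mem_regularSet hm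
      simp only [Integrand.evalChi, Integrand.evalPlus, Fintype.sum_bool, cond_true, cond_false,
        sq_add_sq_div_four, Pi.one_apply]
      field_simp
      ring
  | add a b iha ihb =>
    obtain ⟨ι, _, f, g, hf, hg, h⟩ := iha
    obtain ⟨ι', _, f', g', hf', hg', h'⟩ := ihb
    refine ⟨ι ⊕ ι', inferInstance, Sum.elim f f', Sum.elim g g', ?_, ?_, fun χp hp χm hm => ?_⟩
    · rintro (i | i) <;> simp [hf, hf']
    · rintro (i | i) <;> simp [hg, hg']
    · have e1 := h χp hp χm hm
      have e2 := h' χp hp χm hm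
      simp only [Integrand.evalChi] at e1 e2
      simp [Integrand.evalChi, Integrand.evalPlus, e1, e2]
  | mul a b iha ihb =>
    obtain ⟨ι, _, f, g, hf, hg, h⟩ := iha
    obtain ⟨ι', _, f', g', hf', hg', h'⟩ := ihb
    refine ⟨ι × ι', inferInstance, fun i => f i.1 * f' i.2, fun i => g i.1 * g' i.2,
      fun i => mul_mem_basisSpan (hf _) (hf' _), fun i => mul_mem_basisSpan (hg _) (hg' _),
      fun χp hp χm hm => ?_⟩
    have e1 := h χp hp χm hm
    have e2 := h' χp hp χm hm
    simp only [Integrand.evalChi] at e1 e2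
    simp only [Integrand.evalChi, Integrand.evalPlus, e1, e2]
    rw [Finset.sum_mul_sum, ← Finset.univ_product_univ, Finset.sum_product]
    refine Finset.sum_congr rfl fun i _ => Finset.sum_congr rfl fun j _ => ?_
    simp only [Pi.mul_apply]
    ring
  -- Since ∂_ν χ± = ∓i, the operator D_ν acts as −∂₊ + ∂₋, and every product splits into two.
  | D a iha =>
    obtain ⟨ι, _, f, g, hsep⟩ := iha
    choose f' hf' hdf using fun i => exists_hasDerivAt_of_mem_basisSpan (hsep.1 i)
    choose g' hg' hdg using fun i => exists_hasDerivAt_of_mem_basisSpan (hsep.2.1 i)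
    refine ⟨ι ⊕ ι, inferInstance, Sum.elim (fun i => -f' i) f, Sum.elim g g', ?_, ?_,
      fun χp hp χm hm => ?_⟩
    · rintro (i | i)
      · exact basisSpan.neg_mem (hf' i)
      · exact hsep.1 i
    · rintro (i | i)
      · exact hsep.2.1 i
      · exact hg' i
    · have e1 := neg_I_mul_I_div_two_mul_sub χp χm
      have e2 := I_mul_I_div_two_mul_sub χp χm
      have := hsep.hasDerivAt hdf hdg (n := χp + χm) (ν := I / 2 * (χp - χm))
        (by rwa [e1]) (by rwa [e2])
      rw [e1, e2] at this
      simp only [Integrand.evalChi, Integrand.evalPlus, this.deriv, Fintype.sum_sum_type,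
        Sum.elim_inl, Sum.elim_inr, Pi.neg_apply, Finset.mul_sum]
      rw [← Finset.sum_add_distrib]
      refine Finset.sum_congr rfl fun i _ => ?_
      linear_combination (f' i χp * g i χm - f i χp * g' i χm) * I_sq

theorem exists_isSeparation (e : Integrand) :
    ∃ (m : ℕ) (f g : Fin m → ℂ → ℂ), IsSeparation e f g := by
  obtain ⟨ι, _, f, g, hf, hg, h⟩ := exists_isGlobalSeparation e
  refine ⟨Fintype.card ι, fun i => f ((Fintype.equivFin ι).symm i),
    fun i => g ((Fintype.equivFin ι).symm i), fun i => hf _, fun i => hg _,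
    fun χp χm hp hm => ?_⟩
  rw [h χp (mem_regularSet_of_re_pos hp) χm (mem_regularSet_of_re_pos hm)]
  exact ((Fintype.equivFin ι).symm.sum_comp fun i => f i χp * g i χm).symm

/-! ### The integrand and its continuation at nonnegative integers n. -/

theorem intCast_div_two_add_mem_regularSet {n : ℤ} (hn : 0 ≤ n) {ν : ℝ} (h : n ≠ 0 ∨ ν ≠ 0) :
    (n : ℂ) / 2 - I * ν ∈ regularSet ∧ (n : ℂ) / 2 + I * ν ∈ regularSet := by
  have hn' : (0 : ℝ) ≤ n := by exact_mod_cast hn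
  have hre : ((n : ℂ) / 2).re = (n : ℝ) / 2 := by
    rw [show (n : ℂ) / 2 = ((n / 2 : ℝ) : ℂ) by push_cast; rfl, ofReal_re]
  have him : ((n : ℂ) / 2).im = 0 := by
    rw [show (n : ℂ) / 2 = ((n / 2 : ℝ) : ℂ) by push_cast; rfl, ofReal_im]
  constructor <;> refine mem_regularSet_of_re_nonneg ?_ fun h0 => ?_
  · simp [hre]; linarith
  · have h1 := congrArg re h0
    have h2 := congrArg im h0
    simp [hre, him] at h1 h2
    tauto
  · simp [hre]; linarith
  · have h1 := congrArg re h0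
    have h2 := congrArg im h0
    simp [hre, him] at h1 h2
    tauto

/-- The content is that the real derivative in `eval` equals the complex one in `evalPlus`; complex
differentiability comes from a global separation. The excluded point n = ν = 0 is the pole χ₊ = χ₋ =
0. -/
theorem eval_eq_evalPlus (e : Integrand) {n : ℤ} (hn : 0 ≤ n) {ν : ℝ} (h : n ≠ 0 ∨ ν ≠ 0) :
    e.eval ν n = e.evalPlus ν n := by
  induction e generalizing ν with
  | const c => rfl
  | E => simp only [Integrand.eval, Integrand.evalPlus, bfklE, abs_of_nonneg hn]
  | V => rfl
  | N => rfl
  | add a b iha ihb => simp only [Integrand.eval, Integrand.evalPlus, iha h, ihb h]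
  | mul a b iha ihb => simp only [Integrand.eval, Integrand.evalPlus, iha h, ihb h]
  | D a iha =>
    obtain ⟨ι, _, f, g, hsep⟩ := exists_isGlobalSeparation a
    choose f' hf' hdf using fun i => exists_hasDerivAt_of_mem_basisSpan (hsep.1 i)
    choose g' hg' hdg using fun i => exists_hasDerivAt_of_mem_basisSpan (hsep.2.1 i)
    have hm := intCast_div_two_add_mem_regularSet hn h
    have hd := hsep.hasDerivAt hdf hdg hm.1 hm.2
    -- The derivatives need equality near ν, not just at ν. For n = 0 this uses that ν ≠ 0 is an
    -- open condition.
    have hev : (fun x : ℝ => a.eval x n) =ᶠ[𝓝 ν] fun x : ℝ => a.evalPlus (x : ℂ) n := by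
      rcases h with h | h
      · exact Eventually.of_forall fun x => iha (Or.inl h)
      · filter_upwards [isOpen_ne.mem_nhds h] with x hx using iha (Or.inr hx)
    simp only [Integrand.eval, Integrand.evalPlus]
    rw [hd.deriv, (hd.comp_ofReal.congr_of_eventuallyEq hev).deriv]

/-! ## Plancherel's theorem for truncated Fourier integrals -/

open FourierTransform in
/-- On `L¹ ∩ L²` the `L²` Fourier transform is given by the Fourier integral. -/
theorem fourier_toLp_ae_eq {g : ℝ → ℂ} (h1 : Integrable g) (h2 : MemLp g 2) :
    (𝓕 (h2.toLp g) : Lp (α := ℝ) ℂ 2) =ᵐ[volume] 𝓕 g := by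
  have hcont : Continuous (𝓕 g) := by
    exact VectorFourier.fourierIntegral_continuous Real.continuous_fourierChar
      (by exact continuous_inner) h1
  -- Both sides are tested against φ. The transform moves onto φ: for the L² version by
  -- compatibility with tempered distributions, for the integral by the flip formula.
  refine ae_eq_of_integral_contDiff_smul_eq
    ((Lp.memLp _).locallyIntegrable (by norm_num)) hcont.locallyIntegrable fun φ hφ hc => ?_
  have hc' : HasCompactSupport fun x => (φ x : ℂ) := hc.comp_left (g := ofReal) rfl
  set Φ : SchwartzMap ℝ ℂ := hc'.toSchwartzMap (ofRealCLM.contDiff.comp hφ) with hΦ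
  have hΦx : ∀ x, Φ x = φ x := fun x => rfl
  have e := congrArg (fun u : TemperedDistribution ℝ ℂ => u Φ)
    (Lp.fourier_toTemperedDistribution_eq (h2.toLp g))
  simp only [TemperedDistribution.fourier_apply, Lp.toTemperedDistribution_apply,
    SchwartzMap.fourier_coe] at e
  have e2 : ∫ x, 𝓕 (⇑Φ) x • (h2.toLp g) x = ∫ x, 𝓕 (⇑Φ) x • g x :=
    integral_congr_ae (h2.coeFn_toLp.mono fun x hx => by simp only [hx])
  have e3 : ∫ x, 𝓕 (⇑Φ) x • g x = ∫ x, Φ x • 𝓕 g x := by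
    simpa using! (VectorFourier.integral_fourierIntegral_smul_eq_flip (L := innerₗ ℝ)
      Real.continuous_fourierChar continuous_inner Φ.integrable h1)
  rw [e2, e3] at e
  simpa [hΦx] using e.symm

theorem tendsto_toLp_indicator_Ioc {f : ℝ → ℂ} (hf : MemLp f 2) :
    Tendsto (fun n : ℕ => (hf.indicator (measurableSet_Ioc (a := -(n : ℝ)) (b := n))).toLp _)
      atTop (𝓝 (hf.toLp f)) := by
  rw [Lp.tendsto_Lp_iff_tendsto_eLpNorm'']
  have hfin : ∫⁻ y, ‖f y‖ₑ ^ (2 : ℝ) ≠ ⊤ := by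
    have := (eLpNorm_lt_top_iff_lintegral_rpow_enorm_lt_top (by norm_num) (by norm_num)).mp hf.2
    exact (by simpa using this : _ < _).ne
  have h : Tendsto (fun n : ℕ => ∫⁻ y, ‖((Set.Ioc (-(n : ℝ)) n).indicator f - f) y‖ₑ ^ (2 : ℝ))
      atTop (𝓝 (∫⁻ _ : ℝ, 0)) := by
    refine tendsto_lintegral_of_dominated_convergence' (fun y => ‖f y‖ₑ ^ (2 : ℝ)) (fun n => ?_)
      (fun n => Eventually.of_forall fun y => ?_) hfin (Eventually.of_forall fun y => ?_)
    · exact ((hf.1.indicator measurableSet_Ioc).sub hf.1).enorm.pow_const _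
    · by_cases hy : y ∈ Set.Ioc (-(n : ℝ)) n <;> simp [hy]
    · obtain ⟨N, hN⟩ := exists_nat_gt |y|
      refine tendsto_const_nhds.congr' ?_
      filter_upwards [eventually_ge_atTop N] with n hn
      have hn' : (N : ℝ) ≤ n := by exact_mod_cast hn
      have hy : y ∈ Set.Ioc (-(n : ℝ)) n :=
        ⟨by linarith [neg_abs_le y], by linarith [le_abs_self y]⟩
      simp [hy]
  have h3 := (ENNReal.continuous_rpow_const (y := 1 / 2)).tendsto _ |>.comp h
  simp only [lintegral_zero, ENNReal.zero_rpow_of_pos (show (0 : ℝ) < 1 / 2 by norm_num)] at h3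
  refine h3.congr fun n => ?_
  rw [eLpNorm_eq_lintegral_rpow_enorm_toReal (by norm_num) (by norm_num)]
  simp

/-- If the truncated Fourier integrals of an `L²` function converge almost everywhere, their
limit is the `L²` Fourier transform. -/
theorem ae_eq_fourier_toLp_of_tendsto {f A : ℝ → ℂ} (hf : MemLp f 2)
    (hA : ∀ᵐ ξ : ℝ, Tendsto
      (fun n : ℕ => ∫ y in (-(n : ℝ))..n, exp ((-2 * Real.pi * y * ξ : ℝ) * I) * f y)
      atTop (𝓝 (A ξ))) :
    A =ᵐ[volume] (FourierTransform.fourier (hf.toLp f) : Lp (α := ℝ) ℂ 2) := by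
  have hcont := (Lp.fourierTransformₗᵢ ℝ ℂ).continuous.tendsto (hf.toLp f)
    |>.comp (tendsto_toLp_indicator_Ioc hf)
  -- L² convergence gives pointwise convergence only along a subsequence. This suffices, since the
  -- whole sequence has a limit by assumption.
  obtain ⟨ns, hns, hlim⟩ := (tendstoInMeasure_of_tendsto_Lp hcont).exists_seq_tendsto_ae
  have hint : ∀ n : ℕ, Integrable ((Set.Ioc (-(n : ℝ)) n).indicator f) := fun n => by
    rw [integrable_indicator_iff measurableSet_Ioc]
    exact (hf.restrict _).integrable (by norm_num)
  have hae : ∀ᵐ ξ : ℝ, ∀ n : ℕ,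
      (Lp.fourierTransformₗᵢ ℝ ℂ ((hf.indicator measurableSet_Ioc).toLp
        ((Set.Ioc (-(n : ℝ)) n).indicator f))) ξ =
      FourierTransform.fourier ((Set.Ioc (-(n : ℝ)) n).indicator f) ξ :=
    ae_all_iff.mpr fun n => fourier_toLp_ae_eq (hint n) _
  filter_upwards [hA, hlim, hae] with ξ h1 h2 h3
  refine tendsto_nhds_unique (h1.comp hns.tendsto_atTop) (h2.congr fun n => ?_)
  simp only [Function.comp_apply, h3]
  rw [Real.fourier_real_eq_integral_exp_smul,
    intervalIntegral.integral_of_le (by linarith [(ns n).cast_nonneg (α := ℝ)]),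
    ← integral_indicator measurableSet_Ioc]
  congr 1
  funext y
  by_cases hy : y ∈ Set.Ioc (-(ns n : ℝ)) (ns n) <;> simp [hy]

theorem memLp_of_tendsto_truncated_fourier {f A : ℝ → ℂ} (hf : MemLp f 2)
    (hA : ∀ᵐ ξ : ℝ, Tendsto
      (fun n : ℕ => ∫ y in (-(n : ℝ))..n, exp ((-2 * Real.pi * y * ξ : ℝ) * I) * f y)
      atTop (𝓝 (A ξ))) :
    MemLp A 2 :=
  (Lp.memLp _).ae_eq (ae_eq_fourier_toLp_of_tendsto hf hA).symm

/-- The bilinear form of Plancherel's theorem, for truncated Fourier integrals. -/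
theorem integral_mul_eq_of_tendsto_truncated_fourier {f g A B : ℝ → ℂ}
    (hf : MemLp f 2) (hg : MemLp g 2)
    (hA : ∀ᵐ ξ : ℝ, Tendsto
      (fun n : ℕ => ∫ y in (-(n : ℝ))..n, exp ((-2 * Real.pi * y * ξ : ℝ) * I) * f y)
      atTop (𝓝 (A ξ)))
    (hB : ∀ᵐ ξ : ℝ, Tendsto
      (fun n : ℕ => ∫ y in (-(n : ℝ))..n, exp ((-2 * Real.pi * y * ξ : ℝ) * I) * g y)
      atTop (𝓝 (B ξ))) :
    ∫ ξ, A ξ * B ξ = ∫ y, f (-y) * g y := by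
  -- The L² inner product conjugates one argument. The truncated transforms of conj f(−y) are the
  -- conjugates of those of f, so this substitution turns it into the bilinear form.
  have hF : MemLp (fun y => conj (f (-y))) 2 := by
    have h1 : MemLp (fun y => f (-y)) 2 :=
      hf.comp_measurePreserving (Measure.measurePreserving_neg volume)
    exact h1.star
  have hA' : ∀ᵐ ξ : ℝ, Tendsto (fun n : ℕ => ∫ y in (-(n : ℝ))..n,
      exp ((-2 * Real.pi * y * ξ : ℝ) * I) * conj (f (-y))) atTop (𝓝 (conj (A ξ))) := by
    filter_upwards [hA] with ξ h
    refine ((continuous_conj.tendsto _).comp h).congr fun n => ?_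
    have := intervalIntegral.integral_comp_neg (a := -(n : ℝ)) (b := n)
      (fun y : ℝ => exp ((-2 * Real.pi * y * ξ : ℝ) * I) * f y)
    rw [neg_neg] at this
    rw [Function.comp_apply, ← this, intervalIntegral, intervalIntegral, map_sub, ← integral_conj,
      ← integral_conj]
    congr 1 <;>
    · congr 1
      funext y
      rw [map_mul, ← exp_conj, map_mul, conj_I, conj_ofReal]
      push_cast
      ring_nf
  have e1 := ae_eq_fourier_toLp_of_tendsto hF hA'
  have e2 := ae_eq_fourier_toLp_of_tendsto hg hB
  have key := Lp.inner_fourier_eq (hF.toLp _) (hg.toLp g)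
  rw [L2.inner_def, L2.inner_def] at key
  calc ∫ ξ, A ξ * B ξ = _ := integral_congr_ae ?_
    _ = _ := key
    _ = _ := integral_congr_ae ?_
  · filter_upwards [e1, e2] with ξ h1 h2
    rw [RCLike.inner_apply, ← h1, ← h2]
    simp [mul_comm]
  · filter_upwards [hF.coeFn_toLp, hg.coeFn_toLp] with ξ h1 h2
    rw [RCLike.inner_apply, h1, h2]
    simp [mul_comm]

/-! ## Inverse Mellin transforms -/

/-- Functions on the right half plane with the decay that makes the inverse Mellin transform
converge conditionally. -/
structure MellinAdmissible (h : ℂ → ℂ) : Prop where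
  differentiableAt : ∀ χ : ℂ, 0 < χ.re → DifferentiableAt ℂ h χ
  norm_le : ∃ C, ∀ χ : ℂ, 1 / 4 ≤ χ.re → ‖h χ‖ ≤ C * (1 + ‖χ‖) ^ (-(3 / 4) : ℝ)
  norm_deriv_le : ∃ C, ∀ χ : ℂ, 1 / 4 ≤ χ.re → ‖deriv h χ‖ ≤ C * (1 + ‖χ‖) ^ (-(5 / 4) : ℝ)

theorem inv_norm_le_five_mul {χ : ℂ} (h : 1 / 4 ≤ ‖χ‖) :
    ‖χ‖⁻¹ ≤ 5 * (1 + ‖χ‖) ^ (-1 : ℝ) := by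
  rw [Real.rpow_neg_one, inv_le_comm₀ (by linarith) (by positivity), mul_inv, inv_inv]
  linarith

/-- Slow growth with ε = 1/4 gives −3/4 = 1/4 − 1 for f/χ and −5/4 = (1/4 − 1/2) − 1 for f′/χ, while
f/χ² is smaller still. The first exponent yields square integrability on vertical lines, the second
integrability of the derivative. -/
theorem HasSlowGrowth.mellinAdmissible {f : ℂ → ℂ} (hf : HasSlowGrowth f) :
    MellinAdmissible fun χ => f χ / χ where
  differentiableAt χ hχ := by
    have hm := mem_regularSet_of_re_pos hχ
    exact (hf.differentiableAt χ hm).fun_div differentiableAt_id (ne_zero_of_mem_regularSet hm)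
  norm_le := by
    obtain ⟨C, hC⟩ := hf.norm_le (1 / 4) (by norm_num)
    refine ⟨C * 5, fun χ hχ => ?_⟩
    have h4 : 1 / 4 ≤ ‖χ‖ := hχ.trans (re_le_norm χ)
    have h1 := hC χ (by linarith) h4
    rw [norm_div, div_eq_mul_inv]
    refine (mul_le_mul h1 (inv_norm_le_five_mul h4) (by positivity)
      ((norm_nonneg _).trans h1)).trans (le_of_eq ?_)
    rw [mul_mul_mul_comm, ← Real.rpow_add (by positivity)]
    norm_num
  norm_deriv_le := by
    obtain ⟨C, hC⟩ := hf.norm_le (1 / 4) (by norm_num)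
    obtain ⟨D, hD⟩ := hf.norm_deriv_le (1 / 4) (by norm_num)
    refine ⟨D * 5 + C * 5 * 5, fun χ hχ => ?_⟩
    have h4 : 1 / 4 ≤ ‖χ‖ := hχ.trans (re_le_norm χ)
    have hm := mem_regularSet_of_re_pos (χ := χ) (by linarith)
    have h0 := ne_zero_of_mem_regularSet hm
    have hz : 0 < 1 + ‖χ‖ := by positivity
    have h1 := hC χ (by linarith) h4
    have h2 := hD χ (by linarith) h4
    have h5 := inv_norm_le_five_mul h4
    have e : deriv (fun χ => f χ / χ) χ = deriv f χ * χ⁻¹ - f χ * χ⁻¹ * χ⁻¹ := by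
      rw [((hf.differentiableAt χ hm).hasDerivAt.fun_div (hasDerivAt_id' χ) h0).deriv]
      field_simp
    rw [e]
    refine (norm_sub_le _ _).trans ?_
    rw [norm_mul, norm_mul, norm_mul, norm_inv, add_mul]
    refine add_le_add ((mul_le_mul h2 h5 (by positivity)
      ((norm_nonneg _).trans h2)).trans (le_of_eq ?_)) ((mul_le_mul (mul_le_mul h1 h5 (by positivity)
      ((norm_nonneg _).trans h1)) h5 (by positivity) ?_).trans ?_)
    · rw [mul_mul_mul_comm, ← Real.rpow_add hz]
      norm_num
    · have := (norm_nonneg _).trans h1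
      positivity
    · have hC0 : 0 ≤ C := by
        have := (norm_nonneg _).trans h1
        exact nonneg_of_mul_nonneg_left this (by positivity)
      have e2 : (1 + ‖χ‖) ^ (1 / 4 : ℝ) * (1 + ‖χ‖) ^ (-1 : ℝ) * (1 + ‖χ‖) ^ (-1 : ℝ) ≤
          (1 + ‖χ‖) ^ (-(5 / 4) : ℝ) := by
        rw [← Real.rpow_add hz, ← Real.rpow_add hz]
        exact Real.rpow_le_rpow_of_exponent_le (by linarith) (by norm_num)
      calc _ = C * 5 * 5 * ((1 + ‖χ‖) ^ (1 / 4 : ℝ) * (1 + ‖χ‖) ^ (-1 : ℝ) *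
            (1 + ‖χ‖) ^ (-1 : ℝ)) := by ring
        _ ≤ _ := by gcongr

/-- The truncated inverse Mellin integral along the line `Re s = c`. -/
def lineTrunc (h : ℂ → ℂ) (c x T : ℝ) : ℂ :=
  1 / (2 * Real.pi * I) * ∫ y in (-T)..T, (x : ℂ) ^ (-((c : ℂ) + y * I)) * h (c + y * I) * I

theorem invMellinTrunc_eq_lineTrunc (h : ℂ → ℂ) (x T : ℝ) :
    invMellinTrunc h x T = lineTrunc h (1 / 4) x T := by
  simp [invMellinTrunc, lineTrunc]

theorem abs_le_norm_add_mul_I (c y : ℝ) : |y| ≤ ‖(c : ℂ) + y * I‖ := by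
  simpa using abs_im_le_norm ((c : ℂ) + y * I)

theorem MellinAdmissible.continuous_line {h : ℂ → ℂ} (hh : MellinAdmissible h) {c : ℝ}
    (hc : 1 / 4 ≤ c) : Continuous fun y : ℝ => h (c + y * I) := by
  refine continuous_iff_continuousAt.mpr fun y => ?_
  have h1 : ContinuousAt h ((c : ℂ) + y * I) :=
    (hh.differentiableAt _ (by simp; linarith)).continuousAt
  exact h1.comp (f := fun y : ℝ => (c : ℂ) + y * I) (by fun_prop)

theorem MellinAdmissible.continuous_deriv_line {h : ℂ → ℂ} (hh : MellinAdmissible h) {c : ℝ}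
    (hc : 1 / 4 ≤ c) : Continuous fun y : ℝ => deriv h (c + y * I) := by
  refine continuous_iff_continuousAt.mpr fun y => ?_
  have hopen : IsOpen {z : ℂ | 0 < z.re} := isOpen_lt continuous_const continuous_re
  have hd : DifferentiableOn ℂ h {z : ℂ | 0 < z.re} := fun z hz =>
    (hh.differentiableAt z hz).differentiableWithinAt
  have h1 : ContinuousAt (deriv h) ((c : ℂ) + y * I) :=
    ((hd.deriv hopen).differentiableAt (hopen.mem_nhds (by simp; linarith))).continuousAt
  exact h1.comp (f := fun y : ℝ => (c : ℂ) + y * I) (by fun_prop)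

theorem MellinAdmissible.exists_norm_line_le {h : ℂ → ℂ} (hh : MellinAdmissible h) :
    ∃ C, 0 ≤ C ∧ ∀ c y : ℝ, 1 / 4 ≤ c → ‖h (c + y * I)‖ ≤ C * (1 + |y|) ^ (-(3 / 4) : ℝ) := by
  obtain ⟨C, hC⟩ := hh.norm_le
  have hC0 : 0 ≤ C := nonneg_of_mul_nonneg_left
    ((norm_nonneg _).trans (hC 1 (by norm_num))) (by positivity)
  refine ⟨C, hC0, fun c y hc => (hC _ (by simpa using hc)).trans ?_⟩
  gcongr ?_ * ?_
  exact Real.rpow_le_rpow_of_nonpos (by positivity)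
    (by linarith [abs_le_norm_add_mul_I c y]) (by norm_num)

theorem MellinAdmissible.exists_norm_deriv_line_le {h : ℂ → ℂ} (hh : MellinAdmissible h) :
    ∃ C, 0 ≤ C ∧
      ∀ c y : ℝ, 1 / 4 ≤ c → ‖deriv h (c + y * I)‖ ≤ C * (1 + |y|) ^ (-(5 / 4) : ℝ) := by
  obtain ⟨C, hC⟩ := hh.norm_deriv_le
  have hC0 : 0 ≤ C := nonneg_of_mul_nonneg_left
    ((norm_nonneg _).trans (hC 1 (by norm_num))) (by positivity)
  refine ⟨C, hC0, fun c y hc => (hC _ (by simpa using hc)).trans ?_⟩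
  gcongr ?_ * ?_
  exact Real.rpow_le_rpow_of_nonpos (by positivity)
    (by linarith [abs_le_norm_add_mul_I c y]) (by norm_num)

theorem integrable_one_add_abs_rpow {a : ℝ} (ha : 1 < a) :
    Integrable fun y : ℝ => (1 + |y|) ^ (-a) := by
  simpa using integrable_one_add_norm (E := ℝ) (μ := volume) (r := a) (by simpa using ha)

theorem tendsto_one_add_abs_rpow {a : ℝ} (ha : 0 < a) :
    Tendsto (fun T : ℝ => (1 + |T|) ^ (-a)) atTop (𝓝 0) :=
  (tendsto_rpow_neg_atTop ha).comp (tendsto_atTop_add_const_left _ _ tendsto_abs_atTop_atTop)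

theorem norm_ofReal_cpow_line {x : ℝ} (hx : 0 < x) (c y : ℝ) :
    ‖(x : ℂ) ^ (-((c : ℂ) + y * I))‖ = x ^ (-c) := by
  rw [norm_cpow_eq_rpow_re_of_pos hx]
  simp

/-- Cauchy's theorem on the rectangle between the two lines; the horizontal sides are O(T^(−3/4)).
-/
theorem MellinAdmissible.tendsto_lineTrunc_sub {h : ℂ → ℂ} (hh : MellinAdmissible h) {c x : ℝ}
    (hc : 1 / 4 ≤ c) (hx : 0 < x) :
    Tendsto (fun T => lineTrunc h c x T - lineTrunc h (1 / 4) x T) atTop (𝓝 0) := by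
  obtain ⟨C, hC0, hC⟩ := hh.exists_norm_line_le
  -- The function u ↦ x^(−u) is monotone, increasing or decreasing according to x, so the sum of its
  -- endpoint values dominates it.
  set M : ℝ := x ^ (-(1 / 4) : ℝ) + x ^ (-c) with hM
  have hM0 : 0 < M := by positivity
  have hxu : ∀ u : ℝ, 1 / 4 ≤ u → u ≤ c → x ^ (-u) ≤ M := by
    intro u h1 h2
    rcases le_total x 1 with h | h
    · have := Real.rpow_le_rpow_of_exponent_ge hx h (neg_le_neg h2)
      linarith [Real.rpow_pos_of_pos hx (-(1 / 4))]
    · have := Real.rpow_le_rpow_of_exponent_le h (neg_le_neg h1)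
      linarith [Real.rpow_pos_of_pos hx (-c)]
  set F : ℂ → ℂ := fun s => (x : ℂ) ^ (-s) * h s with hF
  have hx0 : (x : ℂ) ≠ 0 := ofReal_ne_zero.mpr hx.ne'
  have hside : ∀ T : ℝ, ‖∫ u in (1 / 4 : ℝ)..c, F (u + T * I)‖ ≤
      M * (C * (1 + |T|) ^ (-(3 / 4) : ℝ)) * |c - 1 / 4| := by
    intro T
    refine intervalIntegral.norm_integral_le_of_norm_le_const fun u hu => ?_
    rw [Set.uIoc_of_le hc] at hu
    rw [hF, norm_mul, norm_ofReal_cpow_line hx]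
    exact mul_le_mul (hxu u hu.1.le hu.2) (hC u T hu.1.le) (norm_nonneg _) hM0.le
  have hrect : ∀ T : ℝ, lineTrunc h c x T - lineTrunc h (1 / 4) x T =
      1 / (2 * Real.pi * I) * ((∫ u in (1 / 4 : ℝ)..c, F (u + T * I)) -
        ∫ u in (1 / 4 : ℝ)..c, F (u + (-T : ℝ) * I)) := by
    intro T
    have hd : DifferentiableOn ℂ F
        (Set.uIcc ((⟨1 / 4, -T⟩ : ℂ)).re ((⟨c, T⟩ : ℂ)).re ×ℂ
          Set.uIcc ((⟨1 / 4, -T⟩ : ℂ)).im ((⟨c, T⟩ : ℂ)).im) := by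
      intro s hs
      have hre : 1 / 4 ≤ s.re := by
        have := hs.1
        simp only [Set.mem_preimage] at this
        rw [Set.uIcc_of_le hc] at this
        exact this.1
      refine DifferentiableAt.differentiableWithinAt (DifferentiableAt.mul ?_
        (hh.differentiableAt s (by linarith)))
      exact (differentiableAt_id.neg).const_cpow (Or.inl hx0)
    have := integral_boundary_rect_eq_zero_of_differentiableOn F ⟨1 / 4, -T⟩ ⟨c, T⟩ hd
    simp only [smul_eq_mul, ← intervalIntegral.integral_const_mul] at this
    rw [lineTrunc, lineTrunc, ← mul_sub]
    congr 1
    have e : ∀ c : ℝ, (∫ y in (-T)..T, (x : ℂ) ^ (-((c : ℂ) + y * I)) * h (c + y * I) * I) =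
        ∫ y in (-T)..T, I * F (c + y * I) := by
      intro c
      congr 1
      funext y
      rw [hF]
      ring
    rw [e c, e (1 / 4)]
    linear_combination this
  have hlim : Tendsto (fun T : ℝ => ‖1 / (2 * Real.pi * I)‖ *
      (M * (C * (1 + |T|) ^ (-(3 / 4) : ℝ)) * |c - 1 / 4| +
        M * (C * (1 + |T|) ^ (-(3 / 4) : ℝ)) * |c - 1 / 4|)) atTop (𝓝 0) := by
    have h1 := (((tendsto_one_add_abs_rpow (a := 3 / 4) (by norm_num)).const_mul C).const_mul
      M).mul_const |c - 1 / 4|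
    simpa using (h1.add h1).const_mul ‖1 / (2 * Real.pi * I)‖
  refine squeeze_zero_norm (fun T => ?_) hlim
  rw [hrect, norm_mul]
  gcongr
  refine (norm_sub_le _ _).trans (add_le_add (hside T) ?_)
  simpa using hside (-T)

/-- The limit of the truncated inverse Mellin integrals, after an integration by parts. -/
def lineLimit (h : ℂ → ℂ) (c x : ℝ) : ℂ :=
  1 / (2 * Real.pi * Real.log x) *
    ∫ y : ℝ, (x : ℂ) ^ (-((c : ℂ) + y * I)) * deriv h (c + y * I)

theorem continuous_ofReal_cpow_line {x : ℝ} (hx : 0 < x) (c : ℝ) :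
    Continuous fun y : ℝ => (x : ℂ) ^ (-((c : ℂ) + y * I)) := by
  have hx0 : (x : ℂ) ≠ 0 := ofReal_ne_zero.mpr hx.ne'
  exact Continuous.const_cpow (by fun_prop) (Or.inl hx0)

theorem MellinAdmissible.integrable_cpow_mul_deriv {h : ℂ → ℂ} (hh : MellinAdmissible h)
    {c x : ℝ} (hc : 1 / 4 ≤ c) (hx : 0 < x) :
    Integrable fun y : ℝ => (x : ℂ) ^ (-((c : ℂ) + y * I)) * deriv h (c + y * I) := by
  obtain ⟨C, hC0, hC⟩ := hh.exists_norm_deriv_line_le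
  refine Integrable.mono' (((integrable_one_add_abs_rpow (a := 5 / 4) (by norm_num)).const_mul
    C).const_mul (x ^ (-c)))
    ((continuous_ofReal_cpow_line hx c).mul (hh.continuous_deriv_line hc)).aestronglyMeasurable
    (Eventually.of_forall fun y => ?_)
  rw [norm_mul, norm_ofReal_cpow_line hx]
  gcongr
  exact hC c y hc

/-- Decay of order 3/4 is not integrable, so the oscillation of x^(−iy) is used. Integration by
parts costs a factor 1/log x, hence x ≠ 1, and replaces h by its integrable derivative; the boundary
terms vanish in the limit. -/
theorem MellinAdmissible.tendsto_lineTrunc {h : ℂ → ℂ} (hh : MellinAdmissible h) {c x : ℝ}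
    (hc : 1 / 4 ≤ c) (hx : 0 < x) (hx1 : x ≠ 1) :
    Tendsto (lineTrunc h c x) atTop (𝓝 (lineLimit h c x)) := by
  obtain ⟨C, hC0, hC⟩ := hh.exists_norm_line_le
  have hL : Real.log x ≠ 0 := Real.log_ne_zero_of_pos_of_ne_one hx hx1
  have hL' : (Real.log x : ℂ) ≠ 0 := ofReal_ne_zero.mpr hL
  have hx0 : (x : ℂ) ≠ 0 := ofReal_ne_zero.mpr hx.ne'
  have hpi : (Real.pi : ℂ) ≠ 0 := ofReal_ne_zero.mpr Real.pi_ne_zero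
  set u : ℝ → ℂ := fun y => h (c + y * I) with hu
  set v : ℝ → ℂ := fun y => (x : ℂ) ^ (-((c : ℂ) + y * I)) with hv
  have hline : ∀ y : ℝ, HasDerivAt (fun y : ℝ => (c : ℂ) + y * I) I y := fun y => by
    simpa using ((hasDerivAt_id y).ofReal_comp.mul_const I).const_add (c : ℂ)
  have hdu : ∀ y : ℝ, HasDerivAt u (deriv h (c + y * I) * I) y := fun y =>
    (hh.differentiableAt _ (by simp; linarith)).hasDerivAt.comp y (hline y)
  have hdv : ∀ y : ℝ, HasDerivAt v (v y * Real.log x * -I) y := fun y => by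
    have h1 := ((hasDerivAt_neg ((c : ℂ) + y * I)).const_cpow (c := (x : ℂ)) (Or.inl hx0)).comp y
      (hline y)
    rw [← ofReal_log hx.le] at h1
    convert! h1 using 1
    ring
  have hcv : Continuous v := continuous_ofReal_cpow_line hx c
  have hparts : ∀ T : ℝ, lineTrunc h c x T = 1 / (2 * Real.pi * Real.log x) *
      (∫ y in (-T)..T, v y * deriv h (c + y * I)) +
      I / (2 * Real.pi * Real.log x) * (u T * v T - u (-T) * v (-T)) := by
    intro T
    have := intervalIntegral.integral_mul_deriv_eq_deriv_mul (a := -T) (b := T)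
      (fun y _ => hdu y) (fun y _ => hdv y)
      (((hh.continuous_deriv_line hc).mul continuous_const).intervalIntegrable _ _)
      (((hcv.mul continuous_const).mul continuous_const).intervalIntegrable _ _)
    have e1 : (∫ y in (-T)..T, u y * (v y * Real.log x * -I)) =
        -Real.log x * ∫ y in (-T)..T, v y * h (c + y * I) * I := by
      rw [← intervalIntegral.integral_const_mul]
      congr 1
      funext y
      ring
    have e2 : (∫ y in (-T)..T, deriv h (c + y * I) * I * v y) =
        I * ∫ y in (-T)..T, v y * deriv h (c + y * I) := by
      rw [← intervalIntegral.integral_const_mul]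
      congr 1
      funext y
      ring
    rw [e1, e2] at this
    rw [lineTrunc]
    have h3 : (∫ y in (-T)..T, v y * h (c + y * I) * I) =
        -(u T * v T - u (-T) * v (-T) - I * ∫ y in (-T)..T, v y * deriv h (c + y * I))
          / Real.log x := by
      rw [eq_div_iff hL']
      linear_combination -this
    rw [h3]
    field_simp
    linear_combination -(u T * v T - u (-T) * v (-T)) * I_sq
  have hbd : ∀ T : ℝ, ‖u T * v T‖ ≤ C * (1 + |T|) ^ (-(3 / 4) : ℝ) * x ^ (-c) := fun T => by
    rw [norm_mul, hv, norm_ofReal_cpow_line hx]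
    gcongr
    exact hC c T hc
  have hlim0 : Tendsto (fun T : ℝ => C * (1 + |T|) ^ (-(3 / 4) : ℝ) * x ^ (-c)) atTop (𝓝 0) := by
    simpa using ((tendsto_one_add_abs_rpow (a := 3 / 4) (by norm_num)).const_mul C).mul_const
      (x ^ (-c))
  have h1 : Tendsto (fun T : ℝ => u T * v T) atTop (𝓝 0) := squeeze_zero_norm hbd hlim0
  have h2 : Tendsto (fun T : ℝ => u (-T) * v (-T)) atTop (𝓝 0) :=
    squeeze_zero_norm (fun T => by simpa using hbd (-T)) hlim0
  have h3 : Tendsto (fun T : ℝ => ∫ y in (-T)..T, v y * deriv h (c + y * I)) atTop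
      (𝓝 (∫ y : ℝ, v y * deriv h (c + y * I))) :=
    intervalIntegral_tendsto_integral (hh.integrable_cpow_mul_deriv hc hx)
      tendsto_neg_atTop_atBot tendsto_id
  have := (h3.const_mul (1 / (2 * Real.pi * Real.log x : ℂ))).add
    ((h1.sub h2).const_mul (I / (2 * Real.pi * Real.log x : ℂ)))
  rw [sub_zero, mul_zero, add_zero] at this
  exact this.congr fun T => (hparts T).symm

theorem MellinAdmissible.tendsto_invMellinTrunc {h : ℂ → ℂ} (hh : MellinAdmissible h) {x : ℝ}
    (hx : 0 < x) (hx1 : x ≠ 1) :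
    Tendsto (invMellinTrunc h x) atTop (𝓝 (lineLimit h (1 / 4) x)) :=
  (hh.tendsto_lineTrunc le_rfl hx hx1).congr fun T => (invMellinTrunc_eq_lineTrunc h x T).symm

theorem MellinAdmissible.invMellinConverges {h : ℂ → ℂ} (hh : MellinAdmissible h) {x : ℝ}
    (hx : 0 < x) (hx1 : x ≠ 1) : InvMellinConverges h x :=
  ⟨_, hh.tendsto_invMellinTrunc hx hx1⟩

/-- The inverse Mellin transform may be computed along every line `Re s = c` with `c ≥ 1/4`. -/
theorem MellinAdmissible.invMellin_eq_lineLimit {h : ℂ → ℂ} (hh : MellinAdmissible h) {c x : ℝ}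
    (hc : 1 / 4 ≤ c) (hx : 0 < x) (hx1 : x ≠ 1) : invMellin h x = lineLimit h c x := by
  rw [invMellin, (hh.tendsto_invMellinTrunc hx hx1).limUnder_eq]
  have := (hh.tendsto_lineTrunc hc hx hx1).sub (hh.tendsto_lineTrunc le_rfl hx hx1)
  exact (sub_eq_zero.mp (tendsto_nhds_unique this (hh.tendsto_lineTrunc_sub hc hx))).symm

/-- The derivative bound is uniform in the abscissa c, so on the line Re s = c the value is
O(x^(−c)); let c → ∞. -/
theorem MellinAdmissible.invMellin_eq_zero {h : ℂ → ℂ} (hh : MellinAdmissible h) {x : ℝ}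
    (hx1 : 1 < x) : invMellin h x = 0 := by
  have hx : 0 < x := by linarith
  obtain ⟨C, hC0, hC⟩ := hh.exists_norm_deriv_line_le
  set K := ∫ y : ℝ, C * (1 + |y|) ^ (-(5 / 4) : ℝ)
  have hb : ∀ᶠ c : ℝ in atTop, ‖invMellin h x‖ ≤
      ‖1 / (2 * Real.pi * Real.log x : ℂ)‖ * (x ^ (-c) * K) := by
    filter_upwards [eventually_ge_atTop (1 / 4)] with c hc
    rw [hh.invMellin_eq_lineLimit hc hx hx1.ne', lineLimit, norm_mul]
    gcongr
    rw [← integral_const_mul]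
    refine norm_integral_le_of_norm_le (((integrable_one_add_abs_rpow (a := 5 / 4)
      (by norm_num)).const_mul C).const_mul _) (Eventually.of_forall fun y => ?_)
    rw [norm_mul, norm_ofReal_cpow_line hx]
    gcongr
    exact hC c y hc
  have hlim : Tendsto (fun c : ℝ => ‖1 / (2 * Real.pi * Real.log x : ℂ)‖ * (x ^ (-c) * K))
      atTop (𝓝 0) := by
    have := ((tendsto_rpow_atBot_of_base_gt_one x hx1).comp tendsto_neg_atTop_atBot)
    simpa using (this.mul_const K).const_mul ‖1 / (2 * Real.pi * Real.log x : ℂ)‖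
  exact norm_le_zero_iff.mp (ge_of_tendsto hlim hb)

/-! ## Parseval's formula for inverse Mellin transforms -/

/-- A function on the line `Re s = c`, twisted by a character. -/
def twistedLine (h : ℂ → ℂ) (c a y : ℝ) : ℂ := exp ((-2 * Real.pi * y * a : ℝ) * I) * h (c + y * I)

/-- The inverse Mellin transform in the logarithmic variable, rescaled and weighted. -/
def logInvMellin (h : ℂ → ℂ) (c a ξ : ℝ) : ℂ :=
  2 * Real.pi * (Real.exp (2 * Real.pi * c * (ξ + a)) : ℂ) *
    invMellin h (Real.exp (2 * Real.pi * (ξ + a)) : ℝ)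

theorem MellinAdmissible.memLp_twistedLine {h : ℂ → ℂ} (hh : MellinAdmissible h) {c : ℝ}
    (hc : 1 / 4 ≤ c) (a : ℝ) : MemLp (twistedLine h c a) 2 := by
  obtain ⟨C, hC0, hC⟩ := hh.exists_norm_line_le
  have hcont : Continuous (twistedLine h c a) := by
    have := hh.continuous_line hc
    exact Continuous.mul (by fun_prop) this
  rw [memLp_two_iff_integrable_sq_norm hcont.aestronglyMeasurable]
  refine Integrable.mono' ((integrable_one_add_abs_rpow (a := 3 / 2) (by norm_num)).const_mul
    (C ^ 2)) (by fun_prop) (Eventually.of_forall fun y => ?_)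
  rw [twistedLine, norm_mul, norm_exp_ofReal_mul_I, one_mul, Real.norm_eq_abs,
    abs_of_nonneg (by positivity)]
  refine (pow_le_pow_left₀ (norm_nonneg _) (hC c y hc) 2).trans (le_of_eq ?_)
  rw [mul_pow, ← Real.rpow_natCast (_ ^ _), ← Real.rpow_mul (by positivity)]
  norm_num

/-- With x = e^(2π(ξ+a)), the kernel x^(−(c+iy)) is the Fourier kernel in ξ times the twist and the
weight e^(−2πc(ξ+a)). The single excluded ξ corresponds to x = 1. -/
theorem MellinAdmissible.tendsto_twistedLine {h : ℂ → ℂ} (hh : MellinAdmissible h) {c : ℝ}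
    (hc : 1 / 4 ≤ c) (a : ℝ) :
    ∀ᵐ ξ : ℝ, Tendsto (fun n : ℕ => ∫ y in (-(n : ℝ))..n,
      exp ((-2 * Real.pi * y * ξ : ℝ) * I) * twistedLine h c a y) atTop
      (𝓝 (logInvMellin h c a ξ)) := by
  filter_upwards [compl_mem_ae_iff.mpr (measure_singleton (-a))] with ξ hξ
  have hξ0 : ξ + a ≠ 0 := fun h0 => hξ (eq_neg_of_add_eq_zero_left h0)
  set x := Real.exp (2 * Real.pi * (ξ + a)) with hx
  have hx0 : 0 < x := Real.exp_pos _
  have hx1 : x ≠ 1 := by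
    rw [hx, Ne, Real.exp_eq_one_iff]
    exact mul_ne_zero (mul_ne_zero two_ne_zero Real.pi_ne_zero) hξ0
  have h1 := (hh.tendsto_lineTrunc hc hx0 hx1).comp tendsto_natCast_atTop_atTop
  rw [← hh.invMellin_eq_lineLimit hc hx0 hx1] at h1
  refine (h1.const_mul (2 * Real.pi * (Real.exp (2 * Real.pi * c * (ξ + a)) : ℂ))).congr
    fun n => ?_
  have hpi : (Real.pi : ℂ) ≠ 0 := ofReal_ne_zero.mpr Real.pi_ne_zero
  have e : ∀ y : ℝ, exp ((-2 * Real.pi * y * ξ : ℝ) * I) * twistedLine h c a y =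
      (Real.exp (2 * Real.pi * c * (ξ + a)) : ℂ) * I⁻¹ *
        ((x : ℂ) ^ (-((c : ℂ) + y * I)) * h (c + y * I) * I) := by
    intro y
    have hxe : (x : ℂ) ^ (-((c : ℂ) + y * I)) =
        exp (-(2 * Real.pi * c * (ξ + a))) * exp ((-2 * Real.pi * y * ξ : ℝ) * I) *
          exp ((-2 * Real.pi * y * a : ℝ) * I) := by
      rw [cpow_def_of_ne_zero (ofReal_ne_zero.mpr hx0.ne'), ← ofReal_log hx0.le, hx,
        Real.log_exp, ← exp_add, ← exp_add]
      congr 1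
      push_cast
      ring
    have h4 : exp (2 * Real.pi * c * (ξ + a)) * exp (-(2 * Real.pi * c * (ξ + a))) = 1 := by
      rw [← exp_add]; simp
    rw [hxe, twistedLine, ofReal_exp]
    push_cast
    linear_combination (-exp (-2 * Real.pi * y * ξ * I) * exp (-2 * Real.pi * y * a * I) *
      h (c + y * I)) * h4 - (exp (2 * Real.pi * c * (ξ + a)) *
      exp (-(2 * Real.pi * c * (ξ + a))) * exp (-2 * Real.pi * y * ξ * I) *
      exp (-2 * Real.pi * y * a * I) * h (c + y * I)) * inv_mul_cancel₀ I_ne_zero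
  simp only [e]
  rw [intervalIntegral.integral_const_mul, Function.comp_apply, lineTrunc]
  have hI := I_ne_zero
  field_simp

/-! ### The substitution t = e^(2πξ). -/

theorem image_exp_two_pi_mul :
    (fun ξ : ℝ => Real.exp (2 * Real.pi * ξ)) '' Set.univ = Set.Ioi 0 := by
  rw [Set.image_univ]
  ext t
  simp only [Set.mem_range, Set.mem_Ioi]
  refine ⟨fun ⟨ξ, h⟩ => h ▸ Real.exp_pos _, fun h => ⟨Real.log t / (2 * Real.pi), ?_⟩⟩
  rw [mul_div_cancel₀ _ (by positivity), Real.exp_log h]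

theorem hasDerivWithinAt_exp_two_pi_mul (ξ : ℝ) :
    HasDerivWithinAt (fun ξ : ℝ => Real.exp (2 * Real.pi * ξ))
      (Real.exp (2 * Real.pi * ξ) * (2 * Real.pi)) Set.univ ξ := by
  have h : HasDerivAt (fun ξ : ℝ => 2 * Real.pi * ξ) (2 * Real.pi) ξ := by
    simpa using (hasDerivAt_id ξ).const_mul (2 * Real.pi)
  exact h.exp.hasDerivWithinAt

theorem injOn_exp_two_pi_mul : Set.InjOn (fun ξ : ℝ => Real.exp (2 * Real.pi * ξ)) Set.univ := by
  intro a _ b _ h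
  have := Real.exp_injective h
  exact mul_left_cancel₀ (by positivity) this

/-- At c = (n+1)/2 the two weights multiply to t^(n+1) r^(n+1). One factor t together with 2π is the
Jacobian of t = e^(2πξ), which leaves the moment t^n. The shift a = log(r²)/2π turns t into t r². -/
theorem logInvMellin_mul_logInvMellin (hf hg : ℂ → ℂ) {r : ℝ} (hr : 0 < r) (n : ℕ) (ξ : ℝ) :
    logInvMellin hf (((n + 1 : ℕ) : ℝ) / 2) (Real.log (r ^ 2) / (2 * Real.pi)) ξ *
      logInvMellin hg (((n + 1 : ℕ) : ℝ) / 2) 0 ξ =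
    2 * Real.pi * r ^ (n + 1) * (|Real.exp (2 * Real.pi * ξ) * (2 * Real.pi)| •
      ((Real.exp (2 * Real.pi * ξ) : ℂ) ^ n *
        (invMellin hf ((Real.exp (2 * Real.pi * ξ) * r ^ 2 : ℝ) : ℂ) *
          invMellin hg (Real.exp (2 * Real.pi * ξ) : ℝ)))) := by
  have e1 : Real.exp (2 * Real.pi * (ξ + Real.log (r ^ 2) / (2 * Real.pi))) =
      Real.exp (2 * Real.pi * ξ) * r ^ 2 := by
    rw [mul_add, mul_div_cancel₀ _ (by positivity), Real.exp_add, Real.exp_log (by positivity)]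
  have e2 : Real.exp (2 * Real.pi * (((n + 1 : ℕ) : ℝ) / 2) *
      (ξ + Real.log (r ^ 2) / (2 * Real.pi))) *
      Real.exp (2 * Real.pi * (((n + 1 : ℕ) : ℝ) / 2) * (ξ + 0)) =
      Real.exp (2 * Real.pi * ξ) ^ (n + 1) * r ^ (n + 1) := by
    rw [← Real.exp_add, ← Real.exp_nat_mul, ← Real.exp_log (show 0 < r ^ (n + 1) by positivity),
      ← Real.exp_add, Real.log_pow, Real.log_pow]
    congr 1
    field_simp
    push_cast
    ring
  have e2' := congrArg (fun x : ℝ => (x : ℂ)) e2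
  simp only [ofReal_mul, ofReal_pow] at e2'
  rw [logInvMellin, logInvMellin, e1, abs_of_pos (by positivity), real_smul]
  rw [show 2 * Real.pi * (ξ + 0) = 2 * Real.pi * ξ by ring]
  push_cast at e2' ⊢
  linear_combination (4 * Real.pi ^ 2 * invMellin hf (exp (2 * Real.pi * ξ) * r ^ 2) *
    invMellin hg (exp (2 * Real.pi * ξ))) * e2'

theorem MellinAdmissible.integrableOn_pow_mul_invMellin {hf hg : ℂ → ℂ}
    (hhf : MellinAdmissible hf) (hhg : MellinAdmissible hg) {r : ℝ} (hr : 0 < r) (n : ℕ) :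
    IntegrableOn (fun t : ℝ => (t : ℂ) ^ n *
      (invMellin hf ((t * r ^ 2 : ℝ) : ℂ) * invMellin hg t)) (Set.Ioi 0) := by
  have hc : 1 / 4 ≤ ((n + 1 : ℕ) : ℝ) / 2 := by
    have : (0 : ℝ) ≤ n := n.cast_nonneg
    push_cast
    linarith
  have hA := memLp_of_tendsto_truncated_fourier (hhf.memLp_twistedLine hc _)
    (hhf.tendsto_twistedLine hc (Real.log (r ^ 2) / (2 * Real.pi)))
  have hB := memLp_of_tendsto_truncated_fourier (hhg.memLp_twistedLine hc _)
    (hhg.tendsto_twistedLine hc 0)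
  have hint := hA.integrable_mul hB
  rw [← image_exp_two_pi_mul, integrableOn_image_iff_integrableOn_abs_deriv_smul
    MeasurableSet.univ (fun ξ _ => hasDerivWithinAt_exp_two_pi_mul ξ) injOn_exp_two_pi_mul,
    integrableOn_univ]
  have hpi : (Real.pi : ℂ) ≠ 0 := ofReal_ne_zero.mpr Real.pi_ne_zero
  have hr' : (r : ℂ) ≠ 0 := ofReal_ne_zero.mpr hr.ne'
  refine (hint.const_mul (2 * Real.pi * r ^ (n + 1) : ℂ)⁻¹).congr (Eventually.of_forall fun ξ => ?_)
  simp only [Pi.mul_apply]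
  rw [logInvMellin_mul_logInvMellin hf hg hr n ξ, inv_mul_cancel_left₀
    (mul_ne_zero (mul_ne_zero two_ne_zero hpi) (pow_ne_zero _ hr'))]

/-- The `ν`-integrand of the core functional for a single product `f(χ₊) g(χ₋)`. -/
def productIntegrand (hf hg : ℂ → ℂ) (r : ℝ) (n : ℂ) (ν : ℝ) : ℂ :=
  (r : ℂ) ^ (2 * I * ν) * (hf (n / 2 - I * ν) * hg (n / 2 + I * ν))

/-- The factor r^(2iν) is a character of frequency log(r²)/2π; it is attached to the first function,
where Mellin inversion turns it into the dilation by r². -/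
theorem productIntegrand_eq_twistedLine (hf hg : ℂ → ℂ) {r : ℝ} (hr : 0 < r) (n : ℕ) (ν : ℝ) :
    productIntegrand hf hg r n ν =
      twistedLine hf ((n : ℝ) / 2) (Real.log (r ^ 2) / (2 * Real.pi)) (-ν) *
        twistedLine hg ((n : ℝ) / 2) 0 ν := by
  have e : (r : ℂ) ^ (2 * I * ν) = exp ((-2 * Real.pi * (-ν) *
      (Real.log (r ^ 2) / (2 * Real.pi)) : ℝ) * I) := by
    rw [cpow_def_of_ne_zero (ofReal_ne_zero.mpr hr.ne'), ← ofReal_log hr.le, Real.log_pow]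
    congr 1
    have hpi : (Real.pi : ℂ) ≠ 0 := ofReal_ne_zero.mpr Real.pi_ne_zero
    push_cast
    field_simp
  rw [productIntegrand, twistedLine, twistedLine, ← e]
  simp only [mul_zero, ofReal_zero, zero_mul, exp_zero, one_mul]
  push_cast
  rw [show (n : ℂ) / 2 - I * ν = n / 2 + -ν * I by ring, mul_comm I]
  ring

theorem MellinAdmissible.integrable_productIntegrand {hf hg : ℂ → ℂ}
    (hhf : MellinAdmissible hf) (hhg : MellinAdmissible hg) {r : ℝ} (hr : 0 < r) {n : ℕ}
    (hn : n ≠ 0) : Integrable (productIntegrand hf hg r n) := by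
  have hc : 1 / 4 ≤ (n : ℝ) / 2 := by
    have : (1 : ℝ) ≤ n := by exact_mod_cast Nat.one_le_iff_ne_zero.mpr hn
    linarith
  have h1 := (hhf.memLp_twistedLine hc (Real.log (r ^ 2) / (2 * Real.pi))).comp_measurePreserving
    (Measure.measurePreserving_neg volume)
  refine (h1.integrable_mul (hhg.memLp_twistedLine hc 0)).congr (Eventually.of_forall fun ν => ?_)
  exact (productIntegrand_eq_twistedLine hf hg hr n ν).symm

/-- Parseval's formula: the moments of a product of inverse Mellin transforms. -/
theorem MellinAdmissible.integral_pow_mul_invMellin {hf hg : ℂ → ℂ}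
    (hhf : MellinAdmissible hf) (hhg : MellinAdmissible hg) {r : ℝ} (hr : 0 < r) (n : ℕ) :
    ∫ ν, productIntegrand hf hg r ((n + 1 : ℕ) : ℂ) ν =
      2 * Real.pi * r ^ (n + 1) * ∫ t in Set.Ioi (0 : ℝ), (t : ℂ) ^ n *
      (invMellin hf ((t * r ^ 2 : ℝ) : ℂ) * invMellin hg t) := by
  have hc : 1 / 4 ≤ ((n + 1 : ℕ) : ℝ) / 2 := by
    have : (0 : ℝ) ≤ n := n.cast_nonneg
    push_cast
    linarith
  have key := integral_mul_eq_of_tendsto_truncated_fourier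
    (hhf.memLp_twistedLine hc (Real.log (r ^ 2) / (2 * Real.pi))) (hhg.memLp_twistedLine hc 0)
    (hhf.tendsto_twistedLine hc _) (hhg.tendsto_twistedLine hc 0)
  simp only [productIntegrand_eq_twistedLine hf hg hr (n + 1)]
  rw [← key, ← image_exp_two_pi_mul, integral_image_eq_integral_abs_deriv_smul
    MeasurableSet.univ (fun ξ _ => hasDerivWithinAt_exp_two_pi_mul ξ) injOn_exp_two_pi_mul,
    setIntegral_univ, ← integral_const_mul]
  exact integral_congr_ae (Eventually.of_forall fun ξ => logInvMellin_mul_logInvMellin hf hg hr n ξ)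

/-! ## Finite parts of meromorphic singularities -/

theorem tendsto_integral_left_of_continuousOn {k : ℝ → ℂ} {δ : ℝ} (hδ : 0 < δ)
    (hk : ContinuousOn k (Set.Icc 0 δ)) :
    Tendsto (fun ε : ℝ => ∫ ν in ε..δ, k ν) (𝓝[>] 0) (𝓝 (∫ ν in (0 : ℝ)..δ, k ν)) := by
  have h1 := intervalIntegral.continuousOn_primitive_interval_left (μ := volume) (f := k)
    (a := 0) (b := δ) (by
      rw [Set.uIcc_of_le hδ.le]
      exact hk.integrableOn_Icc)
  rw [Set.uIcc_of_le hδ.le] at h1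
  refine (h1 0 (Set.left_mem_Icc.mpr hδ.le)).mono_left ?_
  rw [← nhdsWithin_Ioc_eq_nhdsGT hδ]
  exact nhdsWithin_mono 0 Set.Ioc_subset_Icc_self

theorem integral_inv_pow_add_neg (N : ℕ) {ε δ : ℝ} (hε : 0 < ε) (hδ : 0 < δ) :
    ∫ ν in ε..δ, (((ν : ℂ)⁻¹) ^ (N + 1) + (((-ν : ℝ) : ℂ)⁻¹) ^ (N + 1)) =
      (1 + (-1) ^ (N + 1)) / N * (((ε⁻¹ : ℝ) : ℂ) ^ N - ((δ⁻¹ : ℝ) : ℂ) ^ N) := by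
  have e : ∀ ν : ℝ, ((ν : ℂ)⁻¹) ^ (N + 1) + (((-ν : ℝ) : ℂ)⁻¹) ^ (N + 1) =
      (1 + (-1) ^ (N + 1)) * ((ν ^ (-((N + 1 : ℕ) : ℤ)) : ℝ) : ℂ) := by
    intro ν
    rw [zpow_neg, zpow_natCast]
    push_cast
    rw [inv_neg, neg_pow (ν : ℂ)⁻¹, inv_pow]
    ring
  simp only [e]
  rw [intervalIntegral.integral_const_mul, intervalIntegral.integral_ofReal]
  -- For N = 0 the primitive would be a logarithm, but 1/ν is odd and the integrand vanishes. The
  -- right side is 0 too, its numerator 1 + (−1)^(N+1) being zero.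
  rcases Nat.eq_zero_or_pos N with rfl | hN
  · simp
  · have h0 : (0 : ℝ) ∉ Set.uIcc ε δ := fun h => by
      have := h.1
      exact absurd this (not_le.mpr (lt_min hε hδ))
    rw [integral_zpow (Or.inr ⟨by omega, h0⟩)]
    have h1 : -((N + 1 : ℕ) : ℤ) + 1 = -(N : ℤ) := by push_cast; ring
    have hN' : (N : ℂ) ≠ 0 := Nat.cast_ne_zero.mpr hN.ne'
    rw [h1, zpow_neg, zpow_neg, zpow_natCast, zpow_natCast]
    push_cast
    rw [inv_pow, inv_pow]
    have : (-((N : ℂ) + 1) + 1) = -N := by ring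
    rw [this]
    field_simp
    ring

/-- The symmetrised integral of a pole of order at most `N` at the origin has a finite part. -/
theorem exists_tendsto_integral_sub_polynomial (N : ℕ) {G : ℂ → ℂ} (hG : AnalyticAt ℂ G 0) :
    ∃ δ₀ : ℝ, 0 < δ₀ ∧ ∀ δ : ℝ, 0 < δ → δ < δ₀ → ∃ (p : Polynomial ℂ) (v : ℂ), p.coeff 0 = 0 ∧
      Tendsto (fun ε : ℝ => (∫ ν in ε..δ, (((ν : ℂ)⁻¹) ^ N * G ν +
        (((-ν : ℝ) : ℂ)⁻¹) ^ N * G ((-ν : ℝ) : ℂ))) - p.eval ((ε⁻¹ : ℝ) : ℂ)) (𝓝[>] 0) (𝓝 v) := by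
  have hcont : ∀ G : ℂ → ℂ, AnalyticAt ℂ G 0 → ∃ δ₀ : ℝ, 0 < δ₀ ∧
      ContinuousOn (fun ν : ℝ => G ν) (Set.Ioo (-δ₀) δ₀) ∧
      ContinuousOn (fun ν : ℝ => G ((-ν : ℝ) : ℂ)) (Set.Ioo (-δ₀) δ₀) := by
    intro G hG
    obtain ⟨δ₀, h0, hball⟩ := Metric.eventually_nhds_iff_ball.mp hG.eventually_analyticAt
    refine ⟨δ₀, h0, fun ν hν => ?_, fun ν hν => ?_⟩
    · have h1 : ContinuousAt G (ν : ℂ) := (hball _ (by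
        simpa [abs_lt] using hν)).continuousAt
      exact (h1.comp (f := fun ν : ℝ => (ν : ℂ)) (by fun_prop)).continuousWithinAt
    · have h1 : ContinuousAt G ((-ν : ℝ) : ℂ) := (hball _ (by
        simpa [abs_lt] using hν)).continuousAt
      exact (h1.comp (f := fun ν : ℝ => ((-ν : ℝ) : ℂ)) (by fun_prop)).continuousWithinAt
  induction N generalizing G with
  | zero =>
    obtain ⟨δ₀, h0, h1, h2⟩ := hcont G hG
    refine ⟨δ₀, h0, fun δ hδ hδ' => ⟨0, ∫ ν in (0 : ℝ)..δ, (G ν + G ((-ν : ℝ) : ℂ)),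
      by simp, ?_⟩⟩
    have hsub : Set.Icc 0 δ ⊆ Set.Ioo (-δ₀) δ₀ := fun ν hν =>
      ⟨by linarith [hν.1], by linarith [hν.2]⟩
    simpa using tendsto_integral_left_of_continuousOn hδ
      ((h1.mono hsub).add (h2.mono hsub))
  | succ N ih =>
    -- Writing G z = G 0 + z · `dslope G 0 z` splits off the leading singular term and lowers the
    -- order of the pole by one.
    have hG1 : AnalyticAt ℂ (dslope G 0) 0 := by
      obtain ⟨p, hp⟩ := hG
      exact hp.has_fpower_series_dslope_fslope.analyticAt
    obtain ⟨δ₁, h1, ih⟩ := ih hG1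
    obtain ⟨δ₂, h2, hc1, hc2⟩ := hcont _ hG1
    refine ⟨min δ₁ δ₂, lt_min h1 h2, fun δ hδ hδ' => ?_⟩
    obtain ⟨p, v, hp, hv⟩ := ih δ hδ (hδ'.trans_le (min_le_left _ _))
    set c : ℂ := G 0 * ((1 + (-1) ^ (N + 1)) / N) with hc
    refine ⟨p + Polynomial.C c * Polynomial.X ^ N, v - c * ((δ⁻¹ : ℝ) : ℂ) ^ N, ?_, ?_⟩
    -- When N = 0 the added monomial is a constant, which is allowed only because its coefficient c
    -- is zero: the residue term cancels between ν and −ν.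
    · rcases Nat.eq_zero_or_pos N with rfl | hN
      · simp [hp, hc]
      · simp [hp, Polynomial.coeff_X_pow, hN.ne]
    refine (hv.sub_const (c * ((δ⁻¹ : ℝ) : ℂ) ^ N)).congr' ?_
    filter_upwards [Ioo_mem_nhdsGT hδ] with ε hε
    have hsub : Set.uIcc ε δ ⊆ Set.Ioo (-δ₂) δ₂ := fun ν hν => by
      rw [Set.uIcc_of_le hε.2.le] at hν
      have := hδ'.trans_le (min_le_right _ _)
      exact ⟨by linarith [hν.1, hε.1], by linarith [hν.2]⟩
    have hpos : ∀ ν ∈ Set.uIcc ε δ, (ν : ℂ) ≠ 0 := fun ν hν => by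
      rw [Set.uIcc_of_le hε.2.le] at hν
      exact ofReal_ne_zero.mpr (by linarith [hν.1, hε.1] : (0 : ℝ) < ν).ne'
    have hneg : ∀ ν ∈ Set.uIcc ε δ, ((-ν : ℝ) : ℂ) ≠ 0 := fun ν hν => by
      simpa using hpos ν hν
    have hi1 : ContinuousOn (fun ν : ℝ => (ν : ℂ)⁻¹) (Set.uIcc ε δ) :=
      ContinuousOn.inv₀ (by fun_prop) hpos
    have hi2 : ContinuousOn (fun ν : ℝ => ((-ν : ℝ) : ℂ)⁻¹) (Set.uIcc ε δ) :=
      ContinuousOn.inv₀ (by fun_prop) hneg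
    have hdec : ∀ z : ℂ, z ≠ 0 →
        z⁻¹ ^ (N + 1) * G z = G 0 * z⁻¹ ^ (N + 1) + z⁻¹ ^ N * dslope G 0 z := by
      intro z hz
      have h3 := sub_smul_dslope G 0 z
      rw [sub_zero, smul_eq_mul] at h3
      rw [show G z = G 0 + z * dslope G 0 z by rw [h3]; ring, pow_succ]
      linear_combination (z⁻¹ ^ N * dslope G 0 z) * inv_mul_cancel₀ hz
    have e : (∫ ν in ε..δ, (((ν : ℂ)⁻¹) ^ (N + 1) * G ν +
          (((-ν : ℝ) : ℂ)⁻¹) ^ (N + 1) * G ((-ν : ℝ) : ℂ))) =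
        (∫ ν in ε..δ, G 0 * (((ν : ℂ)⁻¹) ^ (N + 1) + (((-ν : ℝ) : ℂ)⁻¹) ^ (N + 1))) +
        ∫ ν in ε..δ, (((ν : ℂ)⁻¹) ^ N * dslope G 0 ν +
          (((-ν : ℝ) : ℂ)⁻¹) ^ N * dslope G 0 ((-ν : ℝ) : ℂ)) := by
      rw [← intervalIntegral.integral_add]
      · refine intervalIntegral.integral_congr fun ν hν => ?_
        rw [hdec _ (hpos ν hν), hdec _ (hneg ν hν)]
        ring
      · exact (continuousOn_const.mul ((hi1.pow _).add (hi2.pow _))).intervalIntegrable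
      · exact (((hi1.pow _).mul (hc1.mono hsub)).add
          ((hi2.pow _).mul (hc2.mono hsub))).intervalIntegrable
    rw [e, intervalIntegral.integral_const_mul, integral_inv_pow_add_neg N hε.1 hδ]
    simp only [Polynomial.eval_add, Polynomial.eval_mul, Polynomial.eval_C, Polynomial.eval_pow,
      Polynomial.eval_X, hc]
    ring

theorem setOf_lt_abs_eq_union {ε δ : ℝ} (h : ε ≤ δ) (hε : 0 < ε) :
    {ν : ℝ | ε < |ν|} = {ν : ℝ | δ < |ν|} ∪ (Set.Ioc ε δ ∪ Set.Ico (-δ) (-ε)) := by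
  ext ν
  simp only [Set.mem_ofPred_eq, Set.mem_union, Set.mem_Ioc, Set.mem_Ico]
  rcases le_total 0 ν with h0 | h0
  · rw [abs_of_nonneg h0]
    constructor
    · intro h1
      rcases lt_or_ge δ ν with h2 | h2
      · exact Or.inl h2
      · exact Or.inr (Or.inl ⟨h1, h2⟩)
    · rintro (h1 | h1 | h1) <;> linarith [h1]
  · rw [abs_of_nonpos h0]
    constructor
    · intro h1
      rcases lt_or_ge δ (-ν) with h2 | h2
      · exact Or.inl h2
      · exact Or.inr (Or.inr ⟨by linarith, by linarith⟩)
    · rintro (h1 | h1 | h1)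
      · linarith
      · linarith [h1.1]
      · linarith [h1.2]

theorem setIntegral_lt_abs_eq {h : ℝ → ℂ} (hint : ∀ ε : ℝ, 0 < ε → IntegrableOn h {ν | ε < |ν|})
    {ε δ : ℝ} (hle : ε ≤ δ) (hε : 0 < ε) :
    ∫ ν in {ν : ℝ | ε < |ν|}, h ν =
      (∫ ν in ε..δ, (h ν + h (-ν))) + ∫ ν in {ν : ℝ | δ < |ν|}, h ν := by
  have hu := setOf_lt_abs_eq_union hle hε
  have hi := hint ε hε
  rw [hu, integrableOn_union, integrableOn_union] at hi
  obtain ⟨hi1, hi2, hi3⟩ := hi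
  have hm : MeasurableSet {ν : ℝ | δ < |ν|} := measurableSet_lt measurable_const (by fun_prop)
  have hd2 : Disjoint (Set.Ioc ε δ) (Set.Ico (-δ) (-ε)) := by
    rw [Set.disjoint_left]
    intro ν h1 h2
    linarith [h1.1, h2.2]
  have hd1 : Disjoint {ν : ℝ | δ < |ν|} (Set.Ioc ε δ ∪ Set.Ico (-δ) (-ε)) := by
    rw [Set.disjoint_left]
    rintro ν h1 (h2 | h2) <;> simp only [Set.mem_ofPred_eq, lt_abs] at h1 <;>
      rcases h1 with h1 | h1 <;> linarith [h2.1, h2.2]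
  have hr : IntervalIntegrable h volume (-δ) (-ε) := by
    rw [intervalIntegrable_iff_integrableOn_Ico_of_le (by linarith)]
    exact hi3
  rw [hu, setIntegral_union hd1 (measurableSet_Ioc.union measurableSet_Ico) hi1 (hi2.union hi3),
    setIntegral_union hd2 measurableSet_Ico hi2 hi3, add_comm, intervalIntegral.integral_add
    ((intervalIntegrable_iff_integrableOn_Ioc_of_le hle).mpr hi2) (by simpa using ((IntervalIntegrable.iff_comp_neg).mp hr).symm),
    intervalIntegral.integral_comp_neg, intervalIntegral.integral_of_le hle,
    intervalIntegral.integral_of_le (by linarith), integral_Ico_eq_integral_Ioc]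

/-- A function that is integrable away from the origin and meromorphic at the origin has a finite
part. -/
theorem exists_hasFinitePart {h : ℝ → ℂ} {H : ℂ → ℂ}
    (hint : ∀ ε : ℝ, 0 < ε → IntegrableOn h {ν | ε < |ν|}) (hH : MeromorphicAt H 0)
    (heq : ∀ ν : ℝ, ν ≠ 0 → h ν = H ν) : ∃ v, HasFinitePart h v := by
  obtain ⟨N, hN⟩ := hH
  obtain ⟨δ₀, h0, hδ₀⟩ := exists_tendsto_integral_sub_polynomial N hN
  obtain ⟨p, v, hp, hv⟩ := hδ₀ (δ₀ / 2) (by linarith) (by linarith)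
  refine ⟨v + ∫ ν in {ν : ℝ | δ₀ / 2 < |ν|}, h ν, hint, p, hp, (hv.add_const _).congr' ?_⟩
  filter_upwards [Ioo_mem_nhdsGT (show 0 < δ₀ / 2 by linarith)] with ε hε
  rw [setIntegral_lt_abs_eq hint hε.2.le hε.1, add_sub_right_comm]
  congr 2
  refine intervalIntegral.integral_congr fun ν hν => ?_
  rw [Set.uIcc_of_le hε.2.le] at hν
  have hν0 : ν ≠ 0 := (by linarith [hν.1, hε.1] : 0 < ν).ne'
  have hz : ∀ z : ℂ, z ≠ 0 → z⁻¹ ^ N * ((z - 0) ^ N • H z) = H z := by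
    intro z hz
    rw [sub_zero, smul_eq_mul, ← mul_assoc, ← mul_pow, inv_mul_cancel₀ hz, one_pow, one_mul]
  rw [hz _ (ofReal_ne_zero.mpr hν0), hz _ (ofReal_ne_zero.mpr (neg_ne_zero.mpr hν0)), heq ν hν0,
    heq (-ν) (neg_ne_zero.mpr hν0)]

theorem integrableOn_lt_abs {h : ℝ → ℂ} (hc : ContinuousOn h {0}ᶜ) {C : ℝ}
    (hb : ∀ ν : ℝ, 1 / 4 ≤ |ν| → ‖h ν‖ ≤ C * (1 + |ν|) ^ (-(3 / 2) : ℝ)) {ε : ℝ} (hε : 0 < ε) :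
    IntegrableOn h {ν | ε < |ν|} := by
  have hm : MeasurableSet {ν : ℝ | 1 / 4 ≤ |ν|} := measurableSet_le measurable_const (by fun_prop)
  have h1 : IntegrableOn h {ν : ℝ | 1 / 4 ≤ |ν|} := by
    refine Integrable.mono' ((integrable_one_add_abs_rpow (a := 3 / 2)
      (by norm_num)).const_mul C).integrableOn
      ((hc.mono fun ν hν => ?_).aestronglyMeasurable hm) ?_
    · rintro rfl
      simp at hν
      linarith
    · rw [ae_restrict_iff' hm]
      exact Eventually.of_forall hb
  have h2 : IntegrableOn h (Set.Icc ε (1 / 4)) :=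
    (hc.mono fun ν hν => (by linarith [hν.1] : 0 < ν).ne').integrableOn_Icc
  have h3 : IntegrableOn h (Set.Icc (-(1 / 4)) (-ε)) :=
    (hc.mono fun ν hν => (by linarith [hν.2] : ν < 0).ne).integrableOn_Icc
  refine (h1.union (h2.union h3)).mono_set fun ν hν => ?_
  simp only [Set.mem_ofPred_eq, Set.mem_union, Set.mem_Icc] at hν ⊢
  rcases le_or_gt (1 / 4) |ν| with h4 | h4
  · exact Or.inl h4
  · right
    rcases le_total 0 ν with h0 | h0
    · rw [abs_of_nonneg h0] at hν h4
      exact Or.inl ⟨hν.le, h4.le⟩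
    · rw [abs_of_nonpos h0] at hν h4
      exact Or.inr ⟨by linarith, by linarith⟩

/-! ## The `n = 0` term -/

theorem HasSlowGrowth.continuous_comp_mul {f : ℂ → ℂ} (hf : HasSlowGrowth f) {a : ℂ}
    (ha : a = I ∨ a = -I) : ContinuousOn (fun ν : ℝ => f (a * ν)) {0}ᶜ := by
  have hre : ∀ ν : ℝ, (a * ν).re = 0 := by rcases ha with rfl | rfl <;> simp
  have ha0 : a ≠ 0 := by rcases ha with rfl | rfl <;> simp
  intro ν hν
  have hm : a * ν ∈ regularSet := mem_regularSet_of_re_nonneg (hre ν).ge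
    (mul_ne_zero ha0 (ofReal_ne_zero.mpr hν))
  exact ((hf.differentiableAt _ hm).continuousAt.comp (f := fun ν : ℝ => a * (ν : ℂ))
    (by fun_prop)).continuousWithinAt

theorem HasSlowGrowth.meromorphicAt_comp_mul {f : ℂ → ℂ} (hf : HasSlowGrowth f) (a : ℂ) :
    MeromorphicAt (fun z => f (a * z)) 0 := by
  have h1 : MeromorphicAt f (a * 0) := by rw [mul_zero]; exact hf.meromorphicAt
  exact h1.comp_analyticAt (g := fun z => a * z) (analyticAt_const.mul analyticAt_id)

theorem norm_ofReal_cpow_two_I {r : ℝ} (hr : 0 < r) (ν : ℝ) : ‖(r : ℂ) ^ (2 * I * ν)‖ = 1 := by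
  rw [norm_cpow_eq_rpow_re_of_pos hr]
  simp

theorem coreIntegrand_zero_eq {e : Integrand} {ι : Type} [Fintype ι] {f g : ι → ℂ → ℂ}
    (h : IsGlobalSeparation e f g) (w : ℂ) {ν : ℝ} (hν : ν ≠ 0) :
    coreIntegrand e.eval w 0 ν =
      (‖w‖ : ℂ) ^ (2 * I * ν) * (∑ i, f i (-I * ν) * g i (I * ν)) / (ν : ℂ) ^ 2 := by
  have hm := intCast_div_two_add_mem_regularSet le_rfl (Or.inr hν)
  rw [coreIntegrand, eval_eq_evalPlus e le_rfl (Or.inr hν), evalPlus_eq_evalChi,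
    h.2.2 _ hm.1 _ hm.2]
  simp

/-- On the imaginary axis f and g grow at most like |ν|^(1/4) each, so division by ν² leaves the
integrable order −3/2 at infinity. At the origin every factor is meromorphic. -/
theorem exists_hasFinitePart_coreIntegrand (e : Integrand) {w : ℂ} (hw : w ≠ 0) :
    ∃ v, HasFinitePart (coreIntegrand e.eval w 0) v := by
  obtain ⟨ι, _, f, g, hsep⟩ := exists_isGlobalSeparation e
  have hf := fun i => hasSlowGrowth_of_mem_basisSpan (hsep.1 i)
  have hg := fun i => hasSlowGrowth_of_mem_basisSpan (hsep.2.1 i)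
  have hr : 0 < ‖w‖ := norm_pos_iff.mpr hw
  have hr0 : (‖w‖ : ℂ) ≠ 0 := ofReal_ne_zero.mpr hr.ne'
  have hc : ContinuousOn (coreIntegrand e.eval w 0) {0}ᶜ := by
    have h1 : ContinuousOn (fun ν : ℝ => (‖w‖ : ℂ) ^ (2 * I * ν) *
        (∑ i, f i (-I * ν) * g i (I * ν)) / (ν : ℂ) ^ 2) {0}ᶜ := by
      refine ContinuousOn.div (ContinuousOn.mul ?_ ?_) (by fun_prop) fun ν hν =>
        pow_ne_zero 2 (ofReal_ne_zero.mpr hν)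
      · exact (Continuous.const_cpow (by fun_prop) (Or.inl hr0)).continuousOn
      · exact continuousOn_finsetSum _ fun i _ => ((hf i).continuous_comp_mul (Or.inr rfl)).mul
          ((hg i).continuous_comp_mul (Or.inl rfl))
    exact h1.congr fun ν hν => coreIntegrand_zero_eq hsep w hν
  choose C hC using fun i => (hf i).norm_le (1 / 4) (by norm_num)
  choose D hD using fun i => (hg i).norm_le (1 / 4) (by norm_num)
  have hb : ∀ ν : ℝ, 1 / 4 ≤ |ν| → ‖coreIntegrand e.eval w 0 ν‖ ≤
      (∑ i, C i * D i * 25) * (1 + |ν|) ^ (-(3 / 2) : ℝ) := by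
    intro ν hν
    have hν0 : ν ≠ 0 := by
      rintro rfl
      simp at hν
      linarith
    have hz : 0 < 1 + |ν| := by positivity
    have h5 := inv_norm_le_five_mul (χ := (ν : ℂ)) (by simpa using hν)
    rw [Complex.norm_real, Real.norm_eq_abs] at h5
    rw [coreIntegrand_zero_eq hsep w hν0, norm_div, norm_mul, norm_ofReal_cpow_two_I hr, one_mul,
      norm_pow, Complex.norm_real, Real.norm_eq_abs, div_eq_mul_inv, ← inv_pow]
    have hsum : ‖∑ i, f i (-I * ν) * g i (I * ν)‖ ≤
        ∑ i, C i * D i * (1 + |ν|) ^ (1 / 2 : ℝ) := by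
      refine norm_sum_le_of_le _ fun i _ => ?_
      have h1 := hC i (-I * ν) (by simp) (by simpa using hν)
      have h2 := hD i (I * ν) (by simp) (by simpa using hν)
      simp only [norm_mul, norm_neg, norm_I, one_mul, Complex.norm_real, Real.norm_eq_abs]
        at h1 h2
      rw [norm_mul]
      refine (mul_le_mul h1 h2 (norm_nonneg _) ((norm_nonneg _).trans h1)).trans (le_of_eq ?_)
      rw [mul_mul_mul_comm, ← Real.rpow_add hz]
      norm_num
    refine (mul_le_mul hsum (pow_le_pow_left₀ (by positivity) h5 2) (by positivity)
      ((norm_nonneg _).trans hsum)).trans (le_of_eq ?_)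
    rw [Finset.sum_mul, Finset.sum_mul]
    refine Finset.sum_congr rfl fun i _ => ?_
    rw [mul_pow, ← Real.rpow_natCast (_ ^ _), ← Real.rpow_mul hz.le,
      show (-(3 / 2) : ℝ) = 1 / 2 + -1 * (2 : ℕ) by norm_num, Real.rpow_add hz]
    ring
  refine exists_hasFinitePart (H := fun z => (‖w‖ : ℂ) ^ (2 * I * z) *
    (∑ i, f i (-I * z) * g i (I * z)) / z ^ 2) (fun ε hε => integrableOn_lt_abs hc hb hε) ?_
    (fun ν hν => coreIntegrand_zero_eq hsep w hν)
  refine ((AnalyticAt.meromorphicAt ?_).fun_mul ?_).fun_div (AnalyticAt.meromorphicAt (by fun_prop))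
  · simp only [cpow_def_of_ne_zero hr0]
    fun_prop
  · exact MeromorphicAt.fun_sum fun i _ =>
      ((hf i).meromorphicAt_comp_mul _).fun_mul ((hg i).meromorphicAt_comp_mul _)

/-! ## The terms with `n ≠ 0` -/

theorem IsSeparation.mellinAdmissible_left {e : Integrand} {m : ℕ} {f g : Fin m → ℂ → ℂ}
    (h : IsSeparation e f g) (i : Fin m) : MellinAdmissible fun χ => f i χ / χ :=
  (hasSlowGrowth_of_mem_basisSpan (h.left_mem i)).mellinAdmissible

theorem IsSeparation.mellinAdmissible_right {e : Integrand} {m : ℕ} {f g : Fin m → ℂ → ℂ}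
    (h : IsSeparation e f g) (i : Fin m) : MellinAdmissible fun χ => g i χ / χ :=
  (hasSlowGrowth_of_mem_basisSpan (h.right_mem i)).mellinAdmissible

/-- The denominator ν² + n²/4 = χ₊χ₋ supplies the factors 1/χ of both Mellin transforms, and n ≥ 1
puts χ± into the half plane where the separation holds. -/
theorem IsSeparation.coreIntegrand_eq {e : Integrand} {m : ℕ} {f g : Fin m → ℂ → ℂ}
    (h : IsSeparation e f g) (w : ℂ) {n : ℕ} (hn : n ≠ 0) (ν : ℝ) :
    coreIntegrand e.eval w n ν =
      ∑ i, productIntegrand (fun χ => f i χ / χ) (fun χ => g i χ / χ) ‖w‖ n ν := by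
  have hre : ((n : ℂ) / 2).re = (n : ℝ) / 2 := by
    rw [show (n : ℂ) / 2 = ((n / 2 : ℝ) : ℂ) by push_cast; rfl, ofReal_re]
  rw [coreIntegrand, eval_eq_evalPlus e (Int.natCast_nonneg n) (Or.inl (by exact_mod_cast hn)),
    evalPlus_eq_evalChi, Int.cast_natCast, h.eq_sum _ _ (by simpa [hre] using Nat.pos_of_ne_zero hn)
    (by simpa [hre] using Nat.pos_of_ne_zero hn), Finset.mul_sum, Finset.sum_div]
  refine Finset.sum_congr rfl fun i _ => ?_
  have hd : (ν : ℂ) ^ 2 + (n : ℂ) ^ 2 / 4 = ((n : ℂ) / 2 - I * ν) * (n / 2 + I * ν) := by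
    linear_combination (ν : ℂ) ^ 2 * I_sq
  rw [hd, productIntegrand, mul_div_assoc, mul_div_mul_comm]

theorem coreIntegrand_neg {e : Integrand} (he : e.IsSymmetric) (w : ℂ) (n : ℤ) :
    coreIntegrand e.eval w (-n) = coreIntegrand e.eval w n := by
  funext ν
  rw [coreIntegrand, coreIntegrand, (he ν n).1]
  push_cast
  rw [neg_sq]

theorem IsSeparation.integrable_coreIntegrand {e : Integrand} {m : ℕ} {f g : Fin m → ℂ → ℂ}
    (h : IsSeparation e f g) {w : ℂ} (hw : w ≠ 0) {n : ℕ} (hn : n ≠ 0) :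
    Integrable (coreIntegrand e.eval w n) := by
  have hr : 0 < ‖w‖ := norm_pos_iff.mpr hw
  have : coreIntegrand e.eval w n = fun ν =>
      ∑ i, productIntegrand (fun χ => f i χ / χ) (fun χ => g i χ / χ) ‖w‖ n ν :=
    funext fun ν => h.coreIntegrand_eq w hn ν
  rw [this]
  exact integrable_finsetSum _ fun i _ =>
    (h.mellinAdmissible_left i).integrable_productIntegrand (h.mellinAdmissible_right i) hr hn

theorem IsSeparation.integral_coreIntegrand {e : Integrand} {m : ℕ} {f g : Fin m → ℂ → ℂ}
    (h : IsSeparation e f g) {w : ℂ} (hw : w ≠ 0) (n : ℕ) :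
    ∫ ν, coreIntegrand e.eval w ((n + 1 : ℕ) : ℤ) ν =
      ∑ i, 2 * Real.pi * ‖w‖ ^ (n + 1) * ∫ t in Set.Ioi (0 : ℝ), (t : ℂ) ^ n *
        (invMellin (fun χ => f i χ / χ) ((t * ‖w‖ ^ 2 : ℝ) : ℂ) *
          invMellin (fun χ => g i χ / χ) t) := by
  have hr : 0 < ‖w‖ := norm_pos_iff.mpr hw
  have : coreIntegrand e.eval w ((n + 1 : ℕ) : ℤ) = fun ν =>
      ∑ i, productIntegrand (fun χ => f i χ / χ) (fun χ => g i χ / χ) ‖w‖ ((n + 1 : ℕ) : ℂ) ν :=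
    funext fun ν => h.coreIntegrand_eq w n.succ_ne_zero ν
  rw [this, integral_finsetSum _ fun i _ =>
    (h.mellinAdmissible_left i).integrable_productIntegrand (h.mellinAdmissible_right i) hr
      n.succ_ne_zero]
  exact Finset.sum_congr rfl fun i _ =>
    (h.mellinAdmissible_left i).integral_pow_mul_invMellin (h.mellinAdmissible_right i) hr n

/-! ## The outer integral as a geometric series -/

section Outer

variable {f g : ℂ → ℂ} {w : ℂ}

theorem segmentIntegrand_outerIntegrand_eq (hw : w ≠ 0) (t : ℝ) :
    segmentIntegrand (outerIntegrand f g w) w t = w / (t * w + 1) *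
      (invMellin (fun χ => f χ / χ) ((t * ‖w‖ ^ 2 : ℝ) : ℂ) *
        invMellin (fun χ => g χ / χ) t) := by
  have e1 : (t : ℂ) * w * conj w = ((t * ‖w‖ ^ 2 : ℝ) : ℂ) := by
    rw [mul_assoc, mul_conj, normSq_eq_norm_sq]
    push_cast
    ring
  rw [segmentIntegrand, outerIntegrand, e1, mul_div_cancel_right₀ _ hw]
  ring

/-- On the support of the integrand the modulus of `t w` is bounded away from one. -/
theorem mul_norm_le_min_or_eq_zero (hf : MellinAdmissible fun χ => f χ / χ) (hw : w ≠ 0) {t : ℝ}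
    (ht : t ∈ Set.Ioc (0 : ℝ) 1) :
    t * ‖w‖ ≤ min ‖w‖ ‖w‖⁻¹ ∨ invMellin (fun χ => f χ / χ) ((t * ‖w‖ ^ 2 : ℝ) : ℂ) = 0 := by
  have hr : 0 < ‖w‖ := norm_pos_iff.mpr hw
  rcases le_or_gt (t * ‖w‖ ^ 2) 1 with h | h
  · left
    refine le_min (mul_le_of_le_one_left hr.le ht.2) ?_
    rw [le_inv_comm₀ (mul_pos ht.1 hr) hr, ← one_div, le_div_iff₀ (mul_pos ht.1 hr)]
    nlinarith
  · exact Or.inr (hf.invMellin_eq_zero h)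

theorem min_norm_inv_lt_one (hw1 : ‖w‖ ≠ 1) : min ‖w‖ ‖w‖⁻¹ < 1 := by
  rcases lt_or_gt_of_ne hw1 with h | h
  · exact (min_le_left _ _).trans_lt h
  · exact (min_le_right _ _).trans_lt (inv_lt_one_of_one_lt₀ h)

/-- Expands w/(1 + tw) geometrically under the integral. The ratio is at most q = min(|w|, 1/|w|) <
1 wherever the product of transforms is nonzero, even if |w| > 1, so a possible pole at u = −1 does
no harm. -/
theorem doubleCopyConverges_and_hasSum (hf : MellinAdmissible fun χ => f χ / χ)
    (hg : MellinAdmissible fun χ => g χ / χ) (hw : w ≠ 0) (hw1 : ‖w‖ ≠ 1) :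
    DoubleCopyConverges f g w ∧
    HasSum (fun n : ℕ => (-1) ^ n * w ^ (n + 1) * ∫ t in Set.Ioi (0 : ℝ), (t : ℂ) ^ n *
      (invMellin (fun χ => f χ / χ) ((t * ‖w‖ ^ 2 : ℝ) : ℂ) * invMellin (fun χ => g χ / χ) t))
      (doubleCopy f g w) := by
  have hr : 0 < ‖w‖ := norm_pos_iff.mpr hw
  set q := min ‖w‖ ‖w‖⁻¹ with hq
  have hq0 : 0 ≤ q := le_min hr.le (inv_nonneg.mpr hr.le)
  have hq1 : q < 1 := min_norm_inv_lt_one hw1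
  set P : ℝ → ℂ := fun t => invMellin (fun χ => f χ / χ) ((t * ‖w‖ ^ 2 : ℝ) : ℂ) *
    invMellin (fun χ => g χ / χ) t with hP
  have hPq : ∀ t ∈ Set.Ioc (0 : ℝ) 1, t * ‖w‖ ≤ q ∨ P t = 0 := fun t ht =>
    (mul_norm_le_min_or_eq_zero hf hw ht).imp_right fun h => by simp only [hP, h, zero_mul]
  have hint : ∀ n : ℕ, IntegrableOn (fun t : ℝ => (t : ℂ) ^ n * P t) (Set.Ioi 0) := fun n =>
    hf.integrableOn_pow_mul_invMellin hg hr n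
  have hPint : IntegrableOn P (Set.Ioc 0 1) := by
    have := hint 0
    simp only [pow_zero, one_mul] at this
    exact this.mono_set Set.Ioc_subset_Ioi_self
  -- The second transform vanishes for t > 1, which is why the outer integral ends at u = w.
  have hIoc : ∀ n : ℕ, ∫ t in Set.Ioi (0 : ℝ), (t : ℂ) ^ n * P t =
      ∫ t in Set.Ioc (0 : ℝ) 1, (t : ℂ) ^ n * P t := by
    intro n
    refine setIntegral_eq_of_subset_of_forall_sdiff_eq_zero measurableSet_Ioi
      Set.Ioc_subset_Ioi_self fun t ht => ?_
    have h1 : 1 < t := by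
      by_contra h
      exact ht.2 ⟨ht.1, not_lt.mp h⟩
    simp only [hP, hg.invMellin_eq_zero h1, mul_zero]
  set F : ℕ → ℝ → ℂ := fun n t => (-1) ^ n * w ^ (n + 1) * ((t : ℂ) ^ n * P t) with hF
  have hFint : ∀ n, IntegrableOn (F n) (Set.Ioc 0 1) := fun n =>
    ((hint n).mono_set Set.Ioc_subset_Ioi_self).const_mul _
  have hFle : ∀ n, ∀ t ∈ Set.Ioc (0 : ℝ) 1, ‖F n t‖ ≤ q ^ n * (‖w‖ * ‖P t‖) := by
    intro n t ht
    have e : ‖F n t‖ = (t * ‖w‖) ^ n * (‖w‖ * ‖P t‖) := by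
      simp only [hF, norm_mul, norm_pow, norm_neg, norm_one, one_pow, one_mul, Complex.norm_real,
        Real.norm_eq_abs, abs_of_pos ht.1]
      ring
    rw [e]
    rcases hPq t ht with h | h
    · have := ht.1.le
      gcongr
    · simp [h]
  have hsum : ∀ t ∈ Set.Ioc (0 : ℝ) 1, HasSum (fun n => F n t)
      (segmentIntegrand (outerIntegrand f g w) w t) := by
    intro t ht
    rw [segmentIntegrand_outerIntegrand_eq hw]
    change HasSum _ (w / (t * w + 1) * P t)
    rcases hPq t ht with h | h
    · have h1 : ‖-(t * w : ℂ)‖ < 1 := by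
        rw [norm_neg, norm_mul, Complex.norm_real, Real.norm_eq_abs, abs_of_pos ht.1]
        linarith
      have h2 := (hasSum_geometric_of_norm_lt_one h1).mul_left (w * P t)
      convert! h2 using 1
      · funext n
        simp only [hF]
        rw [neg_pow (t * w : ℂ), mul_pow]
        ring
      · rw [sub_neg_eq_add, add_comm (1 : ℂ)]
        ring
    · simp only [hF, h, mul_zero]
      exact hasSum_zero
  have hnorm : Summable fun n => ∫ t in Set.Ioc (0 : ℝ) 1, ‖F n t‖ := by
    refine Summable.of_nonneg_of_le (fun n => integral_nonneg fun t => norm_nonneg _)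
      (fun n => ?_) ((summable_geometric_of_lt_one hq0 hq1).mul_right
        (∫ t in Set.Ioc (0 : ℝ) 1, ‖w‖ * ‖P t‖))
    rw [← integral_const_mul]
    exact setIntegral_mono_on (hFint n).norm ((hPint.norm.const_mul _).const_mul _)
      measurableSet_Ioc (hFle n)
  have hres := hasSum_integral_of_summable_integral_norm hFint hnorm
  have hae : ∀ᵐ t ∂(volume.restrict (Set.Ioc (0 : ℝ) 1)),
      (∑' n, F n t) = segmentIntegrand (outerIntegrand f g w) w t := by
    rw [ae_restrict_iff' measurableSet_Ioc]
    exact Eventually.of_forall fun t ht => (hsum t ht).tsum_eq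
  constructor
  · rw [DoubleCopyConverges, intervalIntegrable_iff_integrableOn_Ioc_of_le zero_le_one]
    have hmeas : AEStronglyMeasurable (segmentIntegrand (outerIntegrand f g w) w)
        (volume.restrict (Set.Ioc (0 : ℝ) 1)) := by
      have : AEStronglyMeasurable (fun t : ℝ => w / (t * w + 1) * P t)
          (volume.restrict (Set.Ioc (0 : ℝ) 1)) :=
        (Measurable.aestronglyMeasurable (by fun_prop)).mul hPint.aestronglyMeasurable
      exact this.congr (Eventually.of_forall fun t =>
        (segmentIntegrand_outerIntegrand_eq hw t).symm)
    refine Integrable.mono' ((hPint.norm.const_mul ‖w‖).const_mul (1 - q)⁻¹) hmeas ?_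
    rw [ae_restrict_iff' measurableSet_Ioc]
    refine Eventually.of_forall fun t ht => ?_
    rw [← (hsum t ht).tsum_eq]
    exact tsum_of_norm_bounded ((hasSum_geometric_of_lt_one hq0 hq1).mul_right _)
      fun n => hFle n t ht
  · rw [doubleCopy, intervalIntegral.integral_of_le zero_le_one, ← integral_congr_ae hae]
    refine hres.congr_fun ?_
    intro n
    simp only [hF]
    rw [integral_const_mul, ← hIoc n]

end Outer

/-! ## The core functional -/

theorem norm_pow_mul_exp_arg (w : ℂ) (n : ℕ) :
    (‖w‖ : ℂ) ^ n * exp (I * n * arg w) = w ^ n := by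
  conv_rhs => rw [← norm_mul_exp_arg_mul_I w, mul_pow, ← exp_nat_mul]
  congr 2
  ring

theorem norm_pow_mul_exp_neg_arg (w : ℂ) (n : ℕ) :
    (‖w‖ : ℂ) ^ n * exp (-(I * n * arg w)) = conj w ^ n := by
  rw [← map_pow, ← norm_pow_mul_exp_arg w n, map_mul, map_pow, conj_ofReal, ← exp_conj]
  simp

theorem IsSeparation.hasSum_coreTerm {e : Integrand} (he : e.IsSymmetric) {m : ℕ}
    {f g : Fin m → ℂ → ℂ} (h : IsSeparation e f g) {w : ℂ} (hw : w ≠ 0) (hw1 : ‖w‖ ≠ 1) :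
    HasSum (coreTerm e.eval w) (-2 * ∑ i, doubleCopy (f i) (g i) w +
      -2 * ∑ i, doubleCopy (f i) (g i) (conj w) +
      1 / (Real.pi : ℂ) * finitePart (coreIntegrand e.eval w 0)) := by
  have hpi : (Real.pi : ℂ) ≠ 0 := ofReal_ne_zero.mpr Real.pi_ne_zero
  have hcw : conj w ≠ 0 := (map_ne_zero _).mpr hw
  have hcw1 : ‖conj w‖ ≠ 1 := by rwa [norm_conj]
  have h1 := (hasSum_sum fun i (_ : i ∈ Finset.univ) => (doubleCopyConverges_and_hasSum
    (h.mellinAdmissible_left i) (h.mellinAdmissible_right i) hw hw1).2).mul_left (-2)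
  have h2 := (hasSum_sum fun i (_ : i ∈ Finset.univ) => (doubleCopyConverges_and_hasSum
    (h.mellinAdmissible_left i) (h.mellinAdmissible_right i) hcw hcw1).2).mul_left (-2)
  -- The index shift turns (−1)^(n+1) into −(−1)^n; together with (1/π)·2π this is the factor −2.
  -- The modulus power and the phase combine to w^(n+1).
  have hpos : HasSum (fun n : ℕ => coreTerm e.eval w ((n + 1 : ℕ) : ℤ))
      (-2 * ∑ i, doubleCopy (f i) (g i) w) := by
    convert! h1 using 1
    funext n
    rw [coreTerm, if_neg (by exact_mod_cast n.succ_ne_zero), h.integral_coreIntegrand hw,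
      Finset.mul_sum, Finset.mul_sum]
    refine Finset.sum_congr rfl fun i _ => ?_
    rw [zpow_natCast, Int.cast_natCast, ← norm_pow_mul_exp_arg w (n + 1)]
    generalize (∫ t in Set.Ioi (0 : ℝ), (t : ℂ) ^ n *
      (invMellin (fun χ => f i χ / χ) ((t * ‖w‖ ^ 2 : ℝ) : ℂ) *
        invMellin (fun χ => g i χ / χ) t)) = J
    field_simp
    ring
  -- By symmetry the ν-integral equals that of the positive index. Only the phase is inverted, which
  -- gives the same series at the conjugate of w.
  have hneg : HasSum (fun n : ℕ => coreTerm e.eval w (-((n : ℤ) + 1)))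
      (-2 * ∑ i, doubleCopy (f i) (g i) (conj w)) := by
    convert! h2 using 1
    funext n
    have hn : -((n : ℤ) + 1) = -((n + 1 : ℕ) : ℤ) := by push_cast; rfl
    rw [hn, coreTerm, if_neg (neg_ne_zero.mpr (by exact_mod_cast n.succ_ne_zero)),
      coreIntegrand_neg he, h.integral_coreIntegrand hw, Finset.mul_sum, Finset.mul_sum]
    refine Finset.sum_congr rfl fun i _ => ?_
    rw [zpow_neg, zpow_natCast, Int.cast_neg, Int.cast_natCast, norm_conj,
      ← norm_pow_mul_exp_neg_arg w (n + 1), ← inv_pow, inv_neg, inv_one, mul_neg, neg_mul]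
    generalize (∫ t in Set.Ioi (0 : ℝ), (t : ℂ) ^ n *
      (invMellin (fun χ => f i χ / χ) ((t * ‖w‖ ^ 2 : ℝ) : ℂ) *
        invMellin (fun χ => g i χ / χ) t)) = J
    field_simp
    ring
  have hzero : coreTerm e.eval w 0 =
      1 / (Real.pi : ℂ) * finitePart (coreIntegrand e.eval w 0) := by
    simp [coreTerm]
  have hnat : HasSum (fun n : ℕ => coreTerm e.eval w (n : ℤ))
      (-2 * ∑ i, doubleCopy (f i) (g i) w + coreTerm e.eval w 0) := by
    simpa using (hasSum_nat_add_iff (f := fun n : ℕ => coreTerm e.eval w (n : ℤ)) 1).mp hpos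
  have := hnat.of_nat_of_neg_add_one hneg
  rw [hzero] at this
  convert! this using 1
  ring

theorem IsSeparation.coreConverges {e : Integrand} (he : e.IsSymmetric) {m : ℕ}
    {f g : Fin m → ℂ → ℂ} (h : IsSeparation e f g) {w : ℂ} (hw : w ≠ 0) (hw1 : ‖w‖ ≠ 1) :
    CoreConverges e.eval w where
  integrable n hn := by
    obtain ⟨k, rfl | rfl⟩ := n.eq_nat_or_neg
    · exact h.integrable_coreIntegrand hw (by simpa using hn)
    · rw [coreIntegrand_neg he]
      exact h.integrable_coreIntegrand hw (by simpa using hn)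
  finitePart_exists := exists_hasFinitePart_coreIntegrand e hw
  summable := (h.hasSum_coreTerm he hw hw1).summable

end DoubleCopy

end

theorem mainTheorem1 (e : DoubleCopy.Integrand) (he : e.IsSymmetric) :
    (∃ (m : ℕ) (f g : Fin m → ℂ → ℂ), DoubleCopy.IsSeparation e f g) ∧
    ∀ w : ℂ, w ≠ 0 → ‖w‖ ≠ 1 →
      DoubleCopy.CoreConverges e.eval w ∧
      ∀ (m : ℕ) (f g : Fin m → ℂ → ℂ), DoubleCopy.IsSeparation e f g →
        (∀ (i : Fin m) (x : ℝ), 0 < x → x ≠ 1 →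
          DoubleCopy.InvMellinConverges (fun χ => f i χ / χ) x ∧
          DoubleCopy.InvMellinConverges (fun χ => g i χ / χ) x) ∧
        (∀ i : Fin m,
          DoubleCopy.DoubleCopyConverges (f i) (g i) w ∧
          DoubleCopy.DoubleCopyConverges (f i) (g i) (starRingEnd ℂ w)) ∧
        DoubleCopy.coreFunctional e.eval w =
          -2 * ∑ i, DoubleCopy.doubleCopy (f i) (g i) w
          + -2 * ∑ i, DoubleCopy.doubleCopy (f i) (g i) (starRingEnd ℂ w)
          + 1 / (Real.pi : ℂ) *
            DoubleCopy.finitePart (fun ν : ℝ =>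
              (‖w‖ : ℂ) ^ (2 * Complex.I * ν) * e.eval ν 0 / (ν : ℂ) ^ 2) := by
  -- Convergence of the core functional does not refer to a separation, so it is read off from one
  -- fixed choice; the identity is then proved for each given separation.
  obtain ⟨m₀, f₀, g₀, h₀⟩ := DoubleCopy.exists_isSeparation e
  refine ⟨⟨m₀, f₀, g₀, h₀⟩, fun w hw hw1 => ⟨h₀.coreConverges he hw hw1, fun m f g h =>
    ⟨fun i x hx hx1 => ⟨(h.mellinAdmissible_left i).invMellinConverges hx hx1,
      (h.mellinAdmissible_right i).invMellinConverges hx hx1⟩, fun i => ⟨?_, ?_⟩, ?_⟩⟩⟩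
  · exact (DoubleCopy.doubleCopyConverges_and_hasSum (h.mellinAdmissible_left i)
      (h.mellinAdmissible_right i) hw hw1).1
  · exact (DoubleCopy.doubleCopyConverges_and_hasSum (h.mellinAdmissible_left i)
      (h.mellinAdmissible_right i) ((map_ne_zero _).mpr hw) (by rwa [RCLike.norm_conj])).1
  · rw [DoubleCopy.coreFunctional, (h.hasSum_coreTerm he hw hw1).tsum_eq]
    congr 3
    funext ν
    simp [DoubleCopy.coreIntegrand]
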